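/- Let $p_0$ be a probability mass function on $\mathbb N=\{0,1,2,\dots\}$ that is convex, i.e. $\Delta p_0(k):=p_0(k+1)-2p_0(k)+p_0(k-1)\ge 0$ for all $k\ge 1$, and whose support is finite, equal to $\{0,\dots,S\}$. For a sequence $p$ put $F_p(k)=\sum_{j=0}^k p(j)$, with $F_p(-1)=0$. Let $X_1,X_2,\dots$ be i.i.d. with pmf $p_0$, let $p_n(j)=\frac1n\sum_{i=1}^n \mathbb 1_{\{X_i=j\}}$ be the empirical pmf, and let the least squares estimator $\hat p_n$ be the unique minimizer of $p\mapsto\frac12\sum_{j\in\mathbb N}(p_n(j)-p(j))^2$ over all square summable convex sequences $p$. Let $s_1<\dots<s_m$ be the interior knots of $p_0$, i.e. the points $k$ with $0<k<S+1$ and $\Delta p_0(k)>0$, let $\mathcal K=\{s_1,\dots,s_m\}$, $s_0=0$ and $s_{m+1}=S+1$. Let $\mathbb U$ be a standard Brownian bridge from $(0,0)$ to $(1,0)$ and $\mathbb W(k)=\mathbb U(F_{p_0}(k))-\mathbb U(F_{p_0}(k-1))$. Let $\hat g$ be the unique minimizer of $\Phi(g)=\frac12\sum_{k=0}^{S+1}(g(k)-\mathbb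 W(k))^2$ over the set $\mathcal C(\mathcal K)$ of all $g\in\mathbb R^{S+2}$ that are convex on $\{s_j,\dots,s_{j+1}\}$ for every $j\in\{0,\dots,m\}$, and let $\widehat{\mathbb G}(x)=\sum_{k=0}^x\hat g(k)$. Let $s\in\{s_1,\dots,s_m\}$, let $\Phi^{\le s}(g)=\frac12\sum_{k=0}^{s}(g(k)-\mathbb W(k))^2$, and let $\mathcal C^{\le s}(\mathcal K)$ be the set of all $g=(g(0),\dots,g(s))\in\mathbb R^{s+1}$ that are convex on $\{s_j,\dots,s_{j+1}\}$ for every $j\in\{0,\dots,m\}$ with $s_{j+1}\le s$. Then $\Phi^{\le s}$ has a unique minimizer over $\mathcal C^{\le s}(\mathcal K)$. For every realization of $\mathbb U$, this minimizer is equal to $(\hat g(0),\dots,\hat g(s))$ if and only if $$\widehat{\mathbb G}(s)=\mathbb U(F_{p_0}(s)).$$ Moreover, $\sqrt n\,(\hat p_n(0)-p_0(0),\dots,\hat p_n(s)-p_0(s))$ converges in distribution, as $n\to\infty$, to the minimizer of $\Phi^{\le s}$ over $\mathcal C^{\le s}(\mathcal K)$ if and only if $$F_{\hat p_n}(s)=F_{p_n}(s)+o_p(n^{-1/2}).$$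 -/

import Mathlib

open MeasureTheory ProbabilityTheory Filter Topology

noncomputable section

namespace ConvexLSE

/-! ### Sequences, probability mass functions, knots -/

/-- `p` is a probability mass function on `ℕ`. -/
structure IsPMF (p : ℕ → ℝ) : Prop where
  nonneg : ∀ k, 0 ≤ p k
  hasSum_one : HasSum p 1

/-- The discrete Laplacian `Δp(k) = p(k+1) - 2 p(k) + p(k-1)`; used only for `k ≥ 1`. -/
def laplacian (p : ℕ → ℝ) (k : ℕ) : ℝ := p (k + 1) - 2 * p k + p (k - 1)

/-- Convexity of a sequence on `ℕ`. -/
def IsConvexSeq (p : ℕ → ℝ) : Prop := ∀ k, 1 ≤ k → 0 ≤ laplacian p k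

/-- The class of convex sequences with finite `ℓ²` norm. -/
def convexClass : Set (ℕ → ℝ) := {p | Memℓp p 2 ∧ IsConvexSeq p}

/-- `F_p(k) = ∑_{j = 0}^k p(j)`. -/
def distFun (p : ℕ → ℝ) (k : ℕ) : ℝ := ∑ j ∈ Finset.range (k + 1), p j

/-- The interior knots of a pmf `p` with support `{0, …, S}`: the points strictly between
`0` and `S + 1` at which `p` is strictly convex. -/
def interiorKnots (p : ℕ → ℝ) (S : ℕ) : Set ℕ := {k | 0 < k ∧ k < S + 1 ∧ 0 < laplacian p k}

/-- The set `{s_0, s_1, …, s_m, s_{m+1}}`: the interior knots `s_1 < ⋯ < s_m`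
together with `s_0 = 0` and `s_{m+1} = S + 1`. -/
def breakpoints (p : ℕ → ℝ) (S : ℕ) : Set ℕ := {0, S + 1} ∪ interiorKnots p S

/-- `a` and `b` are consecutive breakpoints, that is `a = s_j` and `b = s_{j+1}` for some
`j ∈ {0, …, m}`. -/
structure IsPiece (p : ℕ → ℝ) (S a b : ℕ) : Prop where
  left_mem : a ∈ breakpoints p S
  right_mem : b ∈ breakpoints p S
  lt : a < b
  between : ∀ c, a < c → c < b → c ∉ breakpoints p S

/-! ### Minimizers -/

/-- `x` is a minimizer of `Φ` over `C`. -/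
def IsMinimizer {E : Type*} (Φ : E → ℝ) (C : Set E) (x : E) : Prop :=
  x ∈ C ∧ ∀ y ∈ C, Φ x ≤ Φ y

/-- The minimizer of `Φ` over `C` (an arbitrary point if there is none). -/
def minimizer {E : Type*} [Nonempty E] (Φ : E → ℝ) (C : Set E) : E :=
  Classical.epsilon (IsMinimizer Φ C)

/-! ### The empirical pmf and the convex least squares estimator -/

/-- The empirical pmf `p_n(j) = (1/n) ∑_{i = 1}^n 1{X_i = j}`; the observations are numbered
from `0`, so that the first `n` of them are `X 0, …, X (n - 1)`. -/
def empiricalPMF {Ω : Type*} (X : ℕ → Ω → ℕ) (n : ℕ) (ω : Ω) (j : ℕ) : ℝ :=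
  (1 / (n : ℝ)) * ∑ i ∈ Finset.range n, if X i ω = j then 1 else 0

/-- The least squares criterion `½ ∑_{j ∈ ℕ} (q(j) - p(j))²`. -/
def lsCriterion (q p : ℕ → ℝ) : ℝ := 1 / 2 * ∑' j, (q j - p j) ^ 2

/-- The convex least squares estimator `p̂_n`: the minimizer of `p ↦ ½ ∑ (p_n(j) - p(j))²` over
the class of square summable convex sequences. -/
def lse {Ω : Type*} (X : ℕ → Ω → ℕ) (n : ℕ) (ω : Ω) : ℕ → ℝ :=
  minimizer (lsCriterion (empiricalPMF X n ω)) convexClass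

/-! ### The Brownian bridge and the limiting process -/

/-- `U` (restricted to times in `[0, 1]`) is a standard Brownian bridge from `(0, 0)` to `(1, 0)`:
a centered Gaussian process with covariance `min s t - s t`, pinned to `0` at both ends, with
almost surely continuous paths. -/
structure IsBrownianBridge {Ω : Type*} [MeasurableSpace Ω] (U : ℝ → Ω → ℝ) (Q : Measure Ω) :
    Prop where
  gaussian : IsGaussianProcess (fun t : Set.Icc (0 : ℝ) 1 => U t) Q
  mean : ∀ t ∈ Set.Icc (0 : ℝ) 1, ∫ ω, U t ω ∂Q = 0
  cov : ∀ s ∈ Set.Icc (0 : ℝ) 1, ∀ t ∈ Set.Icc (0 : ℝ) 1,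
    covariance (U s) (U t) Q = min s t - s * t
  zero : ∀ ω, U 0 ω = 0
  one : ∀ ω, U 1 ω = 0
  cont : ∀ᵐ ω ∂Q, ContinuousOn (fun t => U t ω) (Set.Icc 0 1)

/-- `W(k) = U(F_p(k)) - U(F_p(k-1))`, where `F_p(-1) = 0`. -/
def increment {Ω : Type*} (U : ℝ → Ω → ℝ) (p : ℕ → ℝ) (ω : Ω) : ℕ → ℝ
  | 0 => U (distFun p 0) ω - U 0 ω
  | k + 1 => U (distFun p (k + 1)) ω - U (distFun p k) ω

/-- The finite sequence `(g(0), …, g(N-1))` is convex on `{a, …, b}`: its second difference at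
`k + 1` is nonnegative whenever `k, k + 1, k + 2` all lie in `{a, …, b}`. -/
def ConvexOnSegment {N : ℕ} (g : Fin N → ℝ) (a b : ℕ) : Prop :=
  ∀ (k : ℕ) (hk : k + 2 < N), a ≤ k → k + 2 ≤ b →
    0 ≤ g ⟨k + 2, hk⟩ - 2 * g ⟨k + 1, by omega⟩ + g ⟨k, by omega⟩

/-- The criterion `½ ∑_{k = 0}^{N-1} (g(k) - w(k))²` on `ℝ^N`. -/
def finCriterion {N : ℕ} (w : ℕ → ℝ) (g : Fin N → ℝ) : ℝ := 1 / 2 * ∑ k : Fin N, (g k - w k) ^ 2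

/-- The set of all `g ∈ ℝ^{S+2}` that are convex on `{s_j, …, s_{j+1}}` for all
`j ∈ {0, …, m}`. -/
def cone (p : ℕ → ℝ) (S : ℕ) : Set (Fin (S + 2) → ℝ) :=
  {g | ∀ a b, IsPiece p S a b → ConvexOnSegment g a b}

/-- The set of all `g ∈ ℝ^{s+1}` that are convex on `{s_j, …, s_{j+1}}` for all
`j ∈ {0, …, m}` with `s_{j+1} ≤ s`. -/
def leftCone (p : ℕ → ℝ) (S s : ℕ) : Set (Fin (s + 1) → ℝ) :=
  {g | ∀ a b, IsPiece p S a b → b ≤ s → ConvexOnSegment g a b}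

/-- The criterion `½ ∑_{k = 0}^{S+1} (g(k) - W(k))²`. -/
def criterion {Ω : Type*} (U : ℝ → Ω → ℝ) (p : ℕ → ℝ) (S : ℕ) (ω : Ω) (g : Fin (S + 2) → ℝ) : ℝ :=
  finCriterion (increment U p ω) g

/-- The left-localized criterion `½ ∑_{k = 0}^s (g(k) - W(k))²`. -/
def leftCriterion {Ω : Type*} (U : ℝ → Ω → ℝ) (p : ℕ → ℝ) (s : ℕ) (ω : Ω)
    (g : Fin (s + 1) → ℝ) : ℝ :=
  finCriterion (increment U p ω) g

/-- `ĝ`: the minimizer of the criterion over `cone p S`. -/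
def gHat {Ω : Type*} (U : ℝ → Ω → ℝ) (p : ℕ → ℝ) (S : ℕ) (ω : Ω) : Fin (S + 2) → ℝ :=
  minimizer (criterion U p S ω) (cone p S)

/-- `Ĝ(x) = ∑_{k = 0}^x ĝ(k)`. -/
def GHat {Ω : Type*} (U : ℝ → Ω → ℝ) (p : ℕ → ℝ) (S : ℕ) (ω : Ω) (x : ℕ) : ℝ :=
  ∑ k ∈ Finset.univ.filter (fun k : Fin (S + 2) => (k : ℕ) ≤ x), gHat U p S ω k

/-- The minimizer of the left-localized criterion over `leftCone p S s`. -/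
def leftMinimizer {Ω : Type*} (U : ℝ → Ω → ℝ) (p : ℕ → ℝ) (S s : ℕ) (ω : Ω) : Fin (s + 1) → ℝ :=
  minimizer (leftCriterion U p s ω) (leftCone p S s)

/-- `R_n = o_p(a_n)`: the ratio `R_n / a_n` tends to `0` in probability. -/
def IsLittleOInProb {Ω : Type*} [MeasurableSpace Ω] (P : Measure Ω) (R : ℕ → Ω → ℝ)
    (a : ℕ → ℝ) : Prop :=
  TendstoInMeasure P (fun n ω => R n ω / a n) atTop (fun _ => 0)

/-! ### The two global minimizers exist and are unique -/

theorem minimizer_eq {E : Type*} [Nonempty E] {Φ : E → ℝ} {C : Set E}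
    (h : ∃! x, IsMinimizer Φ C x) {x : E} (hx : IsMinimizer Φ C x) : minimizer Φ C = x :=
  h.unique (Classical.epsilon_spec h.exists) hx

/-- Projection onto a closed convex set of a Hilbert space. -/
theorem existsUnique_proj {H : Type*} [NormedAddCommGroup H] [InnerProductSpace ℝ H]
    [CompleteSpace H] {C : Set H} (hne : C.Nonempty) (hcl : IsClosed C) (hconv : Convex ℝ C)
    (u : H) : ∃! v, IsMinimizer (fun v => ‖u - v‖ ^ 2) C v := by
  obtain ⟨v, hv, hmin⟩ := exists_norm_eq_iInf_of_complete_convex hne hcl.isComplete hconv u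
  have hin := (norm_eq_iInf_iff_real_inner_le_zero hconv hv).1 hmin
  have key : ∀ w ∈ C, ‖u - v‖ ^ 2 + ‖w - v‖ ^ 2 ≤ ‖u - w‖ ^ 2 := fun w hw => by
    have h1 : u - w = (u - v) - (w - v) := by abel
    rw [h1, norm_sub_sq_real (u - v) (w - v)]
    linarith [hin w hw]
  refine ⟨v, ⟨hv, fun w hw => ?_⟩, fun w hw => ?_⟩
  · have := key w hw
    have := sq_nonneg ‖w - v‖
    simp only
    linarith
  · have h1 := key w hw.1
    have h2 : ‖u - w‖ ^ 2 ≤ ‖u - v‖ ^ 2 := hw.2 v hv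
    have h3 : ‖w - v‖ ^ 2 = 0 := le_antisymm (by linarith) (sq_nonneg _)
    exact sub_eq_zero.1 (norm_eq_zero.1 (by simpa using h3))

theorem existsUnique_gHat {Ω : Type*} (U : ℝ → Ω → ℝ) (p : ℕ → ℝ) (S : ℕ) (ω : Ω) :
    ∃! g, IsMinimizer (criterion U p S ω) (cone p S) g := by
  let C : Set (EuclideanSpace ℝ (Fin (S + 2))) := {v | v.ofLp ∈ cone p S}
  let u : EuclideanSpace ℝ (Fin (S + 2)) := WithLp.toLp 2 fun k => increment U p ω k
  have hcl : IsClosed C := by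
    refine IsClosed.preimage (PiLp.continuous_ofLp 2 _) ?_
    simp only [cone, ConvexOnSegment, Set.ofPred_forall]
    exact isClosed_iInter fun a => isClosed_iInter fun b => isClosed_iInter fun _ =>
      isClosed_iInter fun k => isClosed_iInter fun hk => isClosed_iInter fun _ =>
      isClosed_iInter fun _ => isClosed_le continuous_const (by fun_prop)
  have hconv : Convex ℝ C := by
    intro x hx y hy α β hα hβ _ a b hab k hk h1 h2
    have h3 := mul_nonneg hα (hx a b hab k hk h1 h2)
    have h4 := mul_nonneg hβ (hy a b hab k hk h1 h2)
    simp only [PiLp.add_apply, PiLp.smul_apply, smul_eq_mul]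
    linarith
  have hne : C.Nonempty := ⟨0, fun a b _ k hk _ _ => by simp⟩
  have hcrit : ∀ v : EuclideanSpace ℝ (Fin (S + 2)),
      criterion U p S ω v.ofLp = 1 / 2 * ‖u - v‖ ^ 2 := fun v => by
    rw [EuclideanSpace.norm_sq_eq]
    simp only [criterion, finCriterion, u, PiLp.sub_apply, Real.norm_eq_abs, sq_abs]
    congr 1
    exact Finset.sum_congr rfl fun k _ => by ring
  obtain ⟨v, hv, huniq⟩ := existsUnique_proj hne hcl hconv u
  refine ⟨v.ofLp, ⟨hv.1, fun g hg => ?_⟩, fun g hg => ?_⟩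
  · have h1 : ‖u - v‖ ^ 2 ≤ ‖u - WithLp.toLp 2 g‖ ^ 2 := hv.2 (WithLp.toLp 2 g) hg
    have h2 := hcrit (WithLp.toLp 2 g)
    rw [hcrit]
    simp only at h2
    linarith
  · have h := huniq (WithLp.toLp 2 g) ⟨hg.1, fun w hw => ?_⟩
    · rw [← h]
    · have h1 := hg.2 w.ofLp hw
      have h2 := hcrit (WithLp.toLp 2 g)
      have h3 := hcrit w
      simp only at h2 ⊢
      linarith

/-- The least squares estimator is well defined: for any square summable `q`, there is exactly
one minimizer of the least squares criterion over the class of convex sequences. -/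
theorem existsUnique_ls {q : ℕ → ℝ} (hq : Memℓp q 2) :
    ∃! p, IsMinimizer (lsCriterion q) convexClass p := by
  let C : Set (lp (fun _ : ℕ => ℝ) 2) := {v | IsConvexSeq v}
  let u : lp (fun _ : ℕ => ℝ) 2 := ⟨q, hq⟩
  let f : lp (fun _ : ℕ => ℝ) 2 → ℕ → ℝ := fun v => v
  have hf : Continuous f := lp.uniformContinuous_coe.continuous
  have hev : ∀ k : ℕ, Continuous fun v => f v k := fun k => (continuous_apply k).comp hf
  have hcl : IsClosed C := by
    simp only [C, IsConvexSeq, laplacian, Set.ofPred_forall]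
    refine isClosed_iInter fun k => isClosed_iInter fun _ => isClosed_le continuous_const ?_
    exact ((hev (k + 1)).sub ((hev k).const_mul 2)).add (hev (k - 1))
  have hconv : Convex ℝ C := by
    intro x hx y hy α β hα hβ _ k hk
    have h3 := mul_nonneg hα (hx k hk)
    have h4 := mul_nonneg hβ (hy k hk)
    simp only [laplacian, lp.coeFn_add, lp.coeFn_smul, Pi.add_apply, Pi.smul_apply,
      smul_eq_mul] at h3 h4 ⊢
    linarith
  have hne : C.Nonempty := ⟨0, fun k _ => by simp [laplacian]⟩
  have hcrit : ∀ v : lp (fun _ : ℕ => ℝ) 2, lsCriterion q v = 1 / 2 * ‖u - v‖ ^ 2 := fun v => by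
    have h := lp.norm_rpow_eq_tsum (p := 2) (by norm_num) (u - v)
    simp only [ENNReal.toReal_ofNat, Real.rpow_ofNat, lp.coeFn_sub, Pi.sub_apply,
      Real.norm_eq_abs, sq_abs] at h
    rw [h]
    rfl
  obtain ⟨v, hv, huniq⟩ := existsUnique_proj hne hcl hconv u
  refine ⟨v, ⟨⟨lp.memℓp v, hv.1⟩, fun g hg => ?_⟩, fun g hg => ?_⟩
  · have h1 : ‖u - v‖ ^ 2 ≤ ‖u - ⟨g, hg.1⟩‖ ^ 2 := hv.2 ⟨g, hg.1⟩ hg.2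
    have h2 := hcrit ⟨g, hg.1⟩
    rw [hcrit]
    simp only at h2
    linarith
  · have h := huniq ⟨g, hg.1.1⟩ ⟨hg.1.2, fun w hw => ?_⟩
    · rw [← h]
    · have h1 := hg.2 w ⟨lp.memℓp w, hw⟩
      have h2 := hcrit ⟨g, hg.1.1⟩
      rw [hcrit] at h1
      simp only at h2 ⊢
      linarith

theorem memℓp_empiricalPMF {Ω : Type*} (X : ℕ → Ω → ℕ) (n : ℕ) (ω : Ω) :
    Memℓp (empiricalPMF X n ω) 2 := by
  refine (memℓp_zero ?_).of_exponent_ge (by simp)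
  refine ((Finset.range n).image fun i => X i ω).finite_toSet.subset fun j hj => ?_
  by_contra h
  refine hj ?_
  simp only [Finset.coe_image, Set.mem_image, Finset.coe_range, Set.mem_Iio, not_exists,
    not_and] at h
  rw [empiricalPMF, Finset.sum_eq_zero, mul_zero]
  intro i hi
  rw [if_neg (h i (Finset.mem_range.1 hi))]

theorem lse_isMinimizer {Ω : Type*} (X : ℕ → Ω → ℕ) (n : ℕ) (ω : Ω) :
    IsMinimizer (lsCriterion (empiricalPMF X n ω)) convexClass (lse X n ω) :=
  Classical.epsilon_spec (existsUnique_ls (memℓp_empiricalPMF X n ω)).exists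

theorem gHat_isMinimizer {Ω : Type*} (U : ℝ → Ω → ℝ) (p : ℕ → ℝ) (S : ℕ) (ω : Ω) :
    IsMinimizer (criterion U p S ω) (cone p S) (gHat U p S ω) :=
  Classical.epsilon_spec (existsUnique_gHat U p S ω).exists

end ConvexLSE

end

open ConvexLSE

/-!
The argument is a deterministic identity combined with the continuous mapping theorem; the joint
limit of the estimator on the whole support is not needed.

*Finite-dimensional part.* The minimizer `g` of `½ ∑ (g - w)²` over a closed convex cone is
characterized by `∑ (g - w) h ≥ 0` on the cone and `∑ (g - w) g ≤ 0`
(`IsClosedConvexCone.isMinimizer_iff`), and it is a nonexpansive function of `w`. No convexity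
constraint straddles the knot `s`, so a vector in the left cone may be continued to the right of
`s` by its last value, and a vector in the full cone may be replaced left of `s` by its value at
`s`. Testing with these vectors, the residual of `ĝ` restricted to `{0, …, s}` satisfies the
characterization of the left minimizer as soon as it has total mass zero. This is necessary as
well, since the left cone contains the constants (`leftMinimizer_eq_restrict_iff`).

*The estimator.* The estimate `p̂` may be perturbed in every finitely supported direction that is
convex where `p̂` has no kink (`sum_sub_mul_nonneg_of_isMinimizer`). By consistency `p̂` has, almost
surely and for all large `n`, a kink at each knot of `p₀`. With the indicator of `{0, …, s}` as
direction this gives `F_p̂(s) ≥ F_{p_n}(s)` (`sum_le_sum_of_kink`). With directions supported on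
`{0, …, s - 1}` it shows that `√n (p̂ - p₀)` on `{0, …, s}` is *exactly* the projection onto the
left cone of `√n (p_n - p₀) + R_n e_s`, where `R_n = √n (F_p̂(s) - F_{p_n}(s))`
(`isMinimizer_rescaled`).

*The limit.* The multivariate central limit theorem gives `√n (p_n - p₀) → W` in distribution. If
`R_n → 0` in probability, then Slutsky's lemma and the continuity of the projection give the
localized limit. Conversely, if the localized limit holds, then `√n (F_p̂(s) - F_{p₀}(s))` and
`√n (F_{p_n}(s) - F_{p₀}(s))` have the same limit law, that of `U(F_{p₀}(s))`. Their difference is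
`R_n`, which is eventually nonnegative, and two ordered sequences with the same limit in
distribution differ by a quantity that is negligible in probability (`tendstoInMeasure_sub_of_le`).
-/

noncomputable section

namespace ConvexLSE

/-! ### Least squares projection onto a closed convex cone in `ℝ^N` -/

/-- Vanishing of the first-order term of a quadratic function that is nonnegative to the right
of its zero at the origin. -/
lemma nonneg_of_quadratic_nonneg {a b t₀ : ℝ} (ht₀ : 0 < t₀)
    (h : ∀ t, 0 < t → t ≤ t₀ → 0 ≤ t * a + t ^ 2 * b) : 0 ≤ a := by
  have hlim : Tendsto (fun t : ℝ => a + t * b) (𝓝[>] 0) (𝓝 (a + 0 * b)) :=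
    (Continuous.tendsto (by fun_prop) 0).mono_left nhdsWithin_le_nhds
  have h0 : 0 ≤ a + 0 * b := by
    refine ge_of_tendsto hlim ?_
    filter_upwards [Ioc_mem_nhdsGT ht₀] with t ht
    have := h t ht.1 ht.2
    refine nonneg_of_mul_nonneg_right (a := t) ?_ ht.1
    linarith
  linarith

section Projection

variable {N : ℕ} {C : Set (Fin N → ℝ)} {w w' : ℕ → ℝ} {g g' : Fin N → ℝ}

lemma finCriterion_add_smul (w : ℕ → ℝ) (g h : Fin N → ℝ) (t : ℝ) :
    finCriterion w (g + t • h)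
      = finCriterion w g + (t * ∑ k, (g k - w k) * h k + t ^ 2 * (1 / 2 * ∑ k, h k ^ 2)) := by
  simp only [finCriterion, Finset.mul_sum, ← Finset.sum_add_distrib, Pi.add_apply, Pi.smul_apply,
    smul_eq_mul]
  exact Finset.sum_congr rfl fun k _ => by ring

/-- Closed convex cones in `ℝ^N`, containing the origin, by their closure properties. -/
structure IsClosedConvexCone (C : Set (Fin N → ℝ)) : Prop where
  isClosed : IsClosed C
  zero_mem : 0 ∈ C
  add_mem : ∀ x ∈ C, ∀ y ∈ C, x + y ∈ C
  smul_mem : ∀ c : ℝ, 0 ≤ c → ∀ x ∈ C, c • x ∈ C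

/-- The Karush–Kuhn–Tucker characterization of the projection onto a convex cone: the residual
is nonnegative on the cone, and nonpositive on the projection. -/
lemma IsClosedConvexCone.isMinimizer_iff (hC : IsClosedConvexCone C) :
    IsMinimizer (finCriterion w) C g ↔
      g ∈ C ∧ (∀ h ∈ C, 0 ≤ ∑ k, (g k - w k) * h k) ∧ ∑ k, (g k - w k) * g k ≤ 0 := by
  constructor
  · rintro ⟨hg, hmin⟩
    refine ⟨hg, fun h hh => ?_, ?_⟩
    · refine nonneg_of_quadratic_nonneg (b := 1 / 2 * ∑ k, h k ^ 2) one_pos fun t ht _ => ?_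
      have := hmin _ (hC.add_mem _ hg _ (hC.smul_mem t ht.le _ hh))
      rw [finCriterion_add_smul] at this
      linarith
    · refine neg_nonneg.1 (nonneg_of_quadratic_nonneg (b := 1 / 2 * ∑ k, g k ^ 2) one_pos
        fun t ht ht1 => ?_)
      have := hmin _ (hC.smul_mem (1 - t) (by linarith) _ hg)
      rw [show (1 - t) • g = g + (-t) • g by module, finCriterion_add_smul] at this
      linarith
  · rintro ⟨hg, hnonneg, hself⟩
    refine ⟨hg, fun h hh => ?_⟩
    have hexp := finCriterion_add_smul w g (h - g) 1
    rw [show g + (1 : ℝ) • (h - g) = h by module] at hexp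
    have hsq : 0 ≤ ∑ k, (h - g) k ^ 2 := Finset.sum_nonneg fun k _ => sq_nonneg _
    have hlin : ∑ k, (g k - w k) * (h - g) k
        = ∑ k, (g k - w k) * h k - ∑ k, (g k - w k) * g k := by
      rw [← Finset.sum_sub_distrib]
      exact Finset.sum_congr rfl fun k _ => by simp only [Pi.sub_apply]; ring
    have := hnonneg h hh
    rw [hexp, hlin]
    linarith

/-- The projection onto a convex cone is nonexpansive. -/
lemma IsClosedConvexCone.sum_sq_sub_le (hC : IsClosedConvexCone C)
    (hg : IsMinimizer (finCriterion w) C g) (hg' : IsMinimizer (finCriterion w') C g') :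
    ∑ k, (g k - g' k) ^ 2 ≤ ∑ k : Fin N, (w k - w' k) ^ 2 := by
  obtain ⟨hgC, h1, h2⟩ := hC.isMinimizer_iff.1 hg
  obtain ⟨hgC', h3, h4⟩ := hC.isMinimizer_iff.1 hg'
  have h5 := h1 _ hgC'
  have h6 := h3 _ hgC
  have hnn : 0 ≤ ∑ k : Fin N, ((w k - w' k) - (g k - g' k)) ^ 2 :=
    Finset.sum_nonneg fun k _ => sq_nonneg _
  have hid : ∑ k : Fin N, (w k - w' k) ^ 2 - ∑ k, (g k - g' k) ^ 2
      = ∑ k : Fin N, ((w k - w' k) - (g k - g' k)) ^ 2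
        + 2 * (∑ k, (g k - w k) * g' k + ∑ k, (g' k - w' k) * g k
          - ∑ k, (g k - w k) * g k - ∑ k, (g' k - w' k) * g' k) := by
    simp only [Finset.mul_sum, ← Finset.sum_add_distrib, ← Finset.sum_sub_distrib]
    exact Finset.sum_congr rfl fun k _ => by ring
  linarith

lemma IsClosedConvexCone.existsUnique (hC : IsClosedConvexCone C) (w : ℕ → ℝ) :
    ∃! g, IsMinimizer (finCriterion w) C g := by
  let C' : Set (EuclideanSpace ℝ (Fin N)) := {v | v.ofLp ∈ C}
  let u : EuclideanSpace ℝ (Fin N) := WithLp.toLp 2 fun k => w k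
  have hconv : Convex ℝ C' := fun x hx y hy α β hα hβ _ =>
    hC.add_mem _ (hC.smul_mem α hα _ hx) _ (hC.smul_mem β hβ _ hy)
  have hcrit : ∀ v : EuclideanSpace ℝ (Fin N),
      finCriterion w v.ofLp = 1 / 2 * ‖u - v‖ ^ 2 := fun v => by
    rw [EuclideanSpace.norm_sq_eq]
    simp only [finCriterion, u, PiLp.sub_apply, Real.norm_eq_abs, sq_abs]
    congr 1
    exact Finset.sum_congr rfl fun k _ => by ring
  obtain ⟨v, hv, -⟩ := existsUnique_proj (C := C') ⟨0, hC.zero_mem⟩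
    (hC.isClosed.preimage (PiLp.continuous_ofLp 2 _)) hconv u
  have hmin : IsMinimizer (finCriterion w) C v.ofLp := by
    refine ⟨hv.1, fun g hg => ?_⟩
    have h1 : ‖u - v‖ ^ 2 ≤ ‖u - WithLp.toLp 2 g‖ ^ 2 := hv.2 (WithLp.toLp 2 g) hg
    have h2 := hcrit (WithLp.toLp 2 g)
    rw [hcrit]
    simp only at h2
    linarith
  refine ⟨v.ofLp, hmin, fun g hg => ?_⟩
  have h := hC.sum_sq_sub_le hg hmin
  simp only [sub_self, ne_eq, OfNat.ofNat_ne_zero, not_false_eq_true, zero_pow,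
    Finset.sum_const_zero] at h
  funext k
  have hk := (Finset.sum_eq_zero_iff_of_nonneg fun k _ => sq_nonneg (g k - v.ofLp k)).1
    (le_antisymm h (Finset.sum_nonneg fun k _ => sq_nonneg _)) k (Finset.mem_univ k)
  exact sub_eq_zero.1 (pow_eq_zero_iff two_ne_zero |>.1 hk)

lemma IsClosedConvexCone.isMinimizer_minimizer (hC : IsClosedConvexCone C) (w : ℕ → ℝ) :
    IsMinimizer (finCriterion w) C (minimizer (finCriterion w) C) :=
  Classical.epsilon_spec (hC.existsUnique w).exists

lemma IsClosedConvexCone.continuous_minimizer (hC : IsClosedConvexCone C) :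
    Continuous fun w : ℕ → ℝ => minimizer (finCriterion w) C := by
  refine continuous_pi fun k => continuous_iff_continuousAt.2 fun w => ?_
  refine tendsto_iff_dist_tendsto_zero.2 (squeeze_zero (g := fun w' : ℕ → ℝ =>
    √(∑ k : Fin N, (w' k - w k) ^ 2)) (fun _ => dist_nonneg) (fun w' => ?_) ?_)
  · rw [Real.dist_eq]
    refine Real.abs_le_sqrt (le_trans ?_ (hC.sum_sq_sub_le (hC.isMinimizer_minimizer w')
      (hC.isMinimizer_minimizer w)))
    exact Finset.single_le_sum (f := fun k => (minimizer (finCriterion w') C k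
      - minimizer (finCriterion w) C k) ^ 2) (fun k _ => sq_nonneg _) (Finset.mem_univ k)
  · have : Continuous fun w' : ℕ → ℝ => √(∑ k : Fin N, (w' k - w k) ^ 2) := by fun_prop
    simpa using this.tendsto w

/-- The criterion only depends on the data at the points `0, …, N - 1`. -/
lemma finCriterion_congr (h : ∀ k : Fin N, w k = w' k) :
    (finCriterion w : (Fin N → ℝ) → ℝ) = finCriterion w' := by
  funext g
  simp [finCriterion, h]

end Projection

/-! ### The cones of piecewise convex vectors -/

/-- Vectors that are convex on each of the segments `{a, …, b}`, `(a, b)` ranging over a given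
relation, form a closed convex cone. -/
lemma isClosedConvexCone_convexOnSegment {N : ℕ} (r : ℕ → ℕ → Prop) :
    IsClosedConvexCone {g : Fin N → ℝ | ∀ a b, r a b → ConvexOnSegment g a b} where
  isClosed := by
    simp only [ConvexOnSegment, Set.ofPred_forall]
    exact isClosed_iInter fun a => isClosed_iInter fun b => isClosed_iInter fun _ =>
      isClosed_iInter fun k => isClosed_iInter fun hk => isClosed_iInter fun _ =>
      isClosed_iInter fun _ => isClosed_le continuous_const (by fun_prop)
  zero_mem a b _ k hk _ _ := by simp
  add_mem x hx y hy a b hab k hk h1 h2 := by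
    have h3 := hx a b hab k hk h1 h2
    have h4 := hy a b hab k hk h1 h2
    simp only [Pi.add_apply]
    linarith
  smul_mem c hc x hx a b hab k hk h1 h2 := by
    have h3 := mul_nonneg hc (hx a b hab k hk h1 h2)
    simp only [Pi.smul_apply, smul_eq_mul]
    linarith

lemma isClosedConvexCone_cone (p : ℕ → ℝ) (S : ℕ) : IsClosedConvexCone (cone p S) :=
  isClosedConvexCone_convexOnSegment (IsPiece p S)

lemma isClosedConvexCone_leftCone (p : ℕ → ℝ) (S s : ℕ) :
    IsClosedConvexCone (leftCone p S s) := by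
  convert isClosedConvexCone_convexOnSegment (N := s + 1) fun a b => IsPiece p S a b ∧ b ≤ s
    using 1
  simp only [leftCone, and_imp]

lemma const_mem_cone (p : ℕ → ℝ) (S : ℕ) (c : ℝ) : (fun _ => c) ∈ cone p S :=
  fun a b _ k hk _ _ => le_of_eq (by ring)

lemma const_mem_leftCone (p : ℕ → ℝ) (S s : ℕ) (c : ℝ) : (fun _ => c) ∈ leftCone p S s :=
  fun a b _ _ k hk _ _ => le_of_eq (by ring)

/-- Constants of both signs lie in the cone, so the residual has total mass zero. -/
lemma sum_leftMinimizer_sub_eq_zero {Ω : Type*} (U : ℝ → Ω → ℝ) (p : ℕ → ℝ) (S s : ℕ) (ω : Ω) :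
    ∑ k, (leftMinimizer U p S s ω k - increment U p ω k) = 0 := by
  have h := ((isClosedConvexCone_leftCone p S s).isMinimizer_iff.1
    ((isClosedConvexCone_leftCone p S s).isMinimizer_minimizer (increment U p ω))).2.1
  have h1 := h _ (const_mem_leftCone p S s 1)
  have h2 := h _ (const_mem_leftCone p S s (-1))
  simp only [mul_one, mul_neg, Finset.sum_neg_distrib] at h1 h2
  exact le_antisymm (neg_nonneg.1 h2) h1

lemma sum_gHat_sub_eq_zero {Ω : Type*} (U : ℝ → Ω → ℝ) (p : ℕ → ℝ) (S : ℕ) (ω : Ω) :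
    ∑ k, (gHat U p S ω k - increment U p ω k) = 0 := by
  have h := ((isClosedConvexCone_cone p S).isMinimizer_iff.1 (gHat_isMinimizer U p S ω)).2.1
  have h1 := h _ (const_mem_cone p S 1)
  have h2 := h _ (const_mem_cone p S (-1))
  simp only [mul_one, mul_neg, Finset.sum_neg_distrib] at h1 h2
  exact le_antisymm (neg_nonneg.1 h2) h1

lemma sum_increment {Ω : Type*} (U : ℝ → Ω → ℝ) (p : ℕ → ℝ) {ω : Ω} (h0 : U 0 ω = 0) (s : ℕ) :
    ∑ k ∈ Finset.range (s + 1), increment U p ω k = U (distFun p s) ω := by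
  induction s with
  | zero => simp [increment, h0]
  | succ s ih => rw [Finset.sum_range_succ, ih, increment]; ring

lemma sum_leftMinimizer {Ω : Type*} (U : ℝ → Ω → ℝ) (p : ℕ → ℝ) (S s : ℕ) {ω : Ω}
    (h0 : U 0 ω = 0) : ∑ k, leftMinimizer U p S s ω k = U (distFun p s) ω := by
  have h := sum_leftMinimizer_sub_eq_zero U p S s ω
  rw [Finset.sum_sub_distrib, sub_eq_zero, Fin.sum_univ_eq_sum_range (increment U p ω),
    sum_increment U p h0] at h
  exact h

/-- A sum over `{0, …, S + 1}` splits into the part up to `s` and the rest. -/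
lemma sum_fin_eq_left_add_right {S s : ℕ} (hs : s < S + 1) (f : Fin (S + 2) → ℝ) :
    ∑ k, f k = ∑ k : Fin (s + 1), f (Fin.castLE (Nat.succ_le_succ hs.le) k)
      + ∑ k ∈ Finset.univ.filter (fun k : Fin (S + 2) => ¬ (k : ℕ) ≤ s), f k := by
  rw [← Finset.sum_filter_add_sum_filter_not Finset.univ (fun k : Fin (S + 2) => (k : ℕ) ≤ s)]
  congr 1
  symm
  refine Finset.sum_bij (fun k _ => Fin.castLE (Nat.succ_le_succ hs.le) k) ?_ ?_ ?_ ?_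
  · intro k _
    simpa using Nat.lt_succ_iff.1 k.2
  · intro a _ b _ hab
    simpa using hab
  · intro b hb
    exact ⟨⟨b, Nat.lt_succ_iff.2 (by simpa using hb)⟩, Finset.mem_univ _, rfl⟩
  · intro _ _
    rfl

lemma GHat_eq_sum {Ω : Type*} (U : ℝ → Ω → ℝ) (p : ℕ → ℝ) {S s : ℕ} (hs : s < S + 1) (ω : Ω) :
    GHat U p S ω s
      = ∑ k : Fin (s + 1), gHat U p S ω (Fin.castLE (Nat.succ_le_succ hs.le) k) := by
  have h := sum_fin_eq_left_add_right hs (gHat U p S ω)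
  rw [← Finset.sum_filter_add_sum_filter_not Finset.univ
    (fun k : Fin (S + 2) => (k : ℕ) ≤ s)] at h
  exact add_right_cancel h

/-- A breakpoint `s` never lies in the interior of a piece, so a piece that meets the open
half-line left of `s` ends at `s` or before. -/
lemma IsPiece.le_of_lt {p : ℕ → ℝ} {S a b s : ℕ} (h : IsPiece p S a b)
    (hs : s ∈ breakpoints p S) (has : a < s) : b ≤ s := by
  by_contra hb
  exact h.between s has (not_le.1 hb) hs

/-- Gluing of a vector in the left cone with its last value, and of a constant with the right
half of a vector in the cone; both are in the cone since there is no constraint at `s`. -/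
lemma extend_mem_cone {p : ℕ → ℝ} {S s : ℕ} (hs : s ∈ breakpoints p S)
    {h : Fin (s + 1) → ℝ} (hh : h ∈ leftCone p S s) :
    (fun k : Fin (S + 2) => h ⟨min k s, by omega⟩) ∈ cone p S := by
  intro a b hab k hk h1 h2
  rcases le_or_gt s k with hks | hks
  · simp only [min_eq_right hks, min_eq_right (hks.trans (Nat.le_succ k)),
      min_eq_right (hks.trans (Nat.le_add_right k 2))]
    exact le_of_eq (by ring)
  · have hb := hab.le_of_lt hs (h1.trans_lt hks)
    simpa only [min_eq_left (h2.trans hb), min_eq_left (show k + 1 ≤ s by omega),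
      min_eq_left hks.le] using hh a b hab hb k (by omega) h1 h2

lemma const_extend_mem_cone {p : ℕ → ℝ} {S s : ℕ} (hs : s ∈ breakpoints p S) (hsS : s < S + 1)
    {g : Fin (S + 2) → ℝ} (hg : g ∈ cone p S) :
    (fun k : Fin (S + 2) => g ⟨max k s, by omega⟩) ∈ cone p S := by
  intro a b hab k hk h1 h2
  rcases le_or_gt s k with hks | hks
  · simpa only [max_eq_left hks, max_eq_left (hks.trans (Nat.le_succ k)),
      max_eq_left (hks.trans (Nat.le_add_right k 2))] using hg a b hab k hk h1 h2
  · have hb := hab.le_of_lt hs (h1.trans_lt hks)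
    simp only [max_eq_right (h2.trans hb), max_eq_right (show k + 1 ≤ s by omega),
      max_eq_right hks.le]
    exact le_of_eq (by ring)

lemma restrict_mem_leftCone {p : ℕ → ℝ} {S s : ℕ} (hsS : s < S + 1)
    {g : Fin (S + 2) → ℝ} (hg : g ∈ cone p S) :
    (fun k : Fin (s + 1) => g (Fin.castLE (Nat.succ_le_succ hsS.le) k)) ∈ leftCone p S s :=
  fun a b hab _ k hk h1 h2 => hg a b hab k (by omega) h1 h2

/-- The left minimizer is the restriction of the global one exactly when the latter leaves no
residual mass on `{0, …, s}`. -/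
lemma leftMinimizer_eq_restrict_iff {Ω : Type*} (U : ℝ → Ω → ℝ) (p : ℕ → ℝ) {S s : ℕ}
    (hs : s ∈ interiorKnots p S) {ω : Ω} (h0 : U 0 ω = 0) :
    leftMinimizer U p S s ω
        = (fun k : Fin (s + 1) => gHat U p S ω (Fin.castLE (Nat.succ_le_succ hs.2.1.le) k)) ↔
      GHat U p S ω s = U (distFun p s) ω := by
  have hsb : s ∈ breakpoints p S := Or.inr hs
  have hsS := hs.2.1
  constructor
  · intro h
    rw [GHat_eq_sum U p hsS, ← sum_leftMinimizer U p S s h0, h]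
  · intro h
    have hL := isClosedConvexCone_leftCone p S s
    refine minimizer_eq (hL.existsUnique _) (hL.isMinimizer_iff.2 ?_)
    obtain ⟨hg, hnonneg, hself⟩ :=
      (isClosedConvexCone_cone p S).isMinimizer_iff.1 (gHat_isMinimizer U p S ω)
    have htot := sum_gHat_sub_eq_zero U p S ω
    rw [GHat_eq_sum U p hsS, ← sum_increment U p h0,
      ← Fin.sum_univ_eq_sum_range (increment U p ω), ← sub_eq_zero,
      ← Finset.sum_sub_distrib] at h
    rw [sum_fin_eq_left_add_right hsS] at htot hself
    simp only [Fin.val_castLE] at htot hself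
    rw [h, zero_add] at htot
    -- The residual of `ĝ` has total mass zero on each side of `s`, so the constant parts of the
    -- two glued test vectors contribute nothing.
    refine ⟨restrict_mem_leftCone hsS hg, fun f hf => ?_, ?_⟩
    · have h1 := hnonneg _ (extend_mem_cone hsb hf)
      rw [sum_fin_eq_left_add_right hsS] at h1
      have h2 : ∑ k ∈ Finset.univ.filter (fun k : Fin (S + 2) => ¬ (k : ℕ) ≤ s),
          (gHat U p S ω k - increment U p ω k) * f ⟨min k s, by omega⟩ = 0 := by
        rw [← zero_mul (f (Fin.last s)), ← htot, Finset.sum_mul]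
        refine Finset.sum_congr rfl fun k hk => ?_
        have hk' := (not_le.1 (Finset.mem_filter.1 hk).2).le
        congr 2
        exact Fin.ext (min_eq_right hk')
      rw [h2, add_zero] at h1
      refine h1.trans_eq (Finset.sum_congr rfl fun k _ => ?_)
      congr 2
      exact Fin.ext (min_eq_left (Nat.lt_succ_iff.1 k.2))
    · have h1 := hnonneg _ (const_extend_mem_cone hsb hsS hg)
      rw [sum_fin_eq_left_add_right hsS] at h1
      have h2 : ∑ k : Fin (s + 1), (gHat U p S ω (Fin.castLE (Nat.succ_le_succ hsS.le) k)
          - increment U p ω (Fin.castLE (Nat.succ_le_succ hsS.le) k))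
          * gHat U p S ω ⟨max (Fin.castLE (Nat.succ_le_succ hsS.le) k : Fin (S + 2)) s,
            by have := k.2; simp only [Fin.val_castLE]; omega⟩ = 0 := by
        rw [← zero_mul (gHat U p S ω ⟨s, by omega⟩), ← h, Finset.sum_mul]
        refine Finset.sum_congr rfl fun k _ => ?_
        simp only [Fin.val_castLE, max_eq_right (Nat.lt_succ_iff.1 k.2)]
      rw [h2, zero_add] at h1
      have h3 : ∑ k ∈ Finset.univ.filter (fun k : Fin (S + 2) => ¬ (k : ℕ) ≤ s),
          (gHat U p S ω k - increment U p ω k) * gHat U p S ω ⟨max k s, by omega⟩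
          = ∑ k ∈ Finset.univ.filter (fun k : Fin (S + 2) => ¬ (k : ℕ) ≤ s),
          (gHat U p S ω k - increment U p ω k) * gHat U p S ω k := by
        refine Finset.sum_congr rfl fun k hk => ?_
        have hk' := (not_le.1 (Finset.mem_filter.1 hk).2).le
        congr 2
        exact Fin.ext (max_eq_left hk')
      rw [h3] at h1
      linarith

/-! ### Variational inequality for the least squares estimator -/

lemma laplacian_add_mul (p h : ℕ → ℝ) (t : ℝ) (k : ℕ) :
    laplacian (fun j => p j + t * h j) k = laplacian p k + t * laplacian h k := by
  simp only [laplacian]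
  ring

lemma laplacian_eq_zero_of_lt {h : ℕ → ℝ} {N : ℕ} (hh : ∀ k, N ≤ k → h k = 0) {k : ℕ}
    (hk : N + 1 ≤ k) : laplacian h k = 0 := by
  simp [laplacian, hh (k + 1) (by omega), hh k (by omega), hh (k - 1) (by omega)]

lemma memℓp_two_of_support {h : ℕ → ℝ} {N : ℕ} (hh : ∀ k, N ≤ k → h k = 0) : Memℓp h 2 := by
  refine (memℓp_zero ?_).of_exponent_ge (by simp)
  refine (Finset.range N).finite_toSet.subset fun j hj => ?_
  by_contra hjN
  exact hj (hh j (by simpa using hjN))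

lemma summable_sq_sub {q p : ℕ → ℝ} (hq : Memℓp q 2) (hp : Memℓp p 2) :
    Summable fun j => (q j - p j) ^ 2 := by
  simpa using (memℓp_gen_iff (p := 2) (by norm_num)).1 (hq.sub hp)

lemma lsCriterion_add_mul {q p h : ℕ → ℝ} (hq : Memℓp q 2) (hp : Memℓp p 2) {N : ℕ}
    (hh : ∀ k, N ≤ k → h k = 0) (t : ℝ) :
    lsCriterion q (fun j => p j + t * h j) = lsCriterion q p
      + (t * ∑ k ∈ Finset.range N, (p k - q k) * h k
        + t ^ 2 * (1 / 2 * ∑ k ∈ Finset.range N, h k ^ 2)) := by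
  have h1 : HasSum (fun j => t * (2 * ((p j - q j) * h j)) + t ^ 2 * h j ^ 2)
      (∑ j ∈ Finset.range N, (t * (2 * ((p j - q j) * h j)) + t ^ 2 * h j ^ 2)) :=
    hasSum_sum_of_ne_finset_zero fun j hj => by
      simp [hh j (by simpa using hj)]
  have h2 := (summable_sq_sub hq hp).hasSum.add h1
  have h3 : (fun j => (q j - (p j + t * h j)) ^ 2)
      = fun j => (q j - p j) ^ 2 + (t * (2 * ((p j - q j) * h j)) + t ^ 2 * h j ^ 2) := by
    funext j
    ring
  simp only [lsCriterion]
  rw [h3, h2.tsum_eq, Finset.sum_add_distrib, ← Finset.mul_sum, ← Finset.mul_sum,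
    ← Finset.mul_sum]
  ring

/-- The least squares estimate `p` may be perturbed in any finitely supported direction that is
convex wherever `p` has no kink. At the kinks the direction is arbitrary: there are finitely many
that matter, and a small multiple of the direction does not destroy their positive curvature. -/
lemma sum_sub_mul_nonneg_of_isMinimizer {q p h : ℕ → ℝ} (hq : Memℓp q 2)
    (hp : IsMinimizer (lsCriterion q) convexClass p) {N : ℕ} (hh : ∀ k, N ≤ k → h k = 0)
    (hdir : ∀ k, 1 ≤ k → 0 ≤ laplacian h k ∨ 0 < laplacian p k) :
    0 ≤ ∑ k ∈ Finset.range N, (p k - q k) * h k := by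
  have hev : ∀ᶠ t in 𝓝[>] (0 : ℝ), ∀ k ∈ Finset.range (N + 1), 1 ≤ k →
      0 ≤ laplacian p k + t * laplacian h k := by
    refine (Filter.eventually_all_finset _).2 fun k _ => ?_
    rw [eventually_imp_distrib_left]
    intro hk
    rcases hdir k hk with h0 | h0
    · filter_upwards [self_mem_nhdsWithin] with t ht
      exact add_nonneg (hp.1.2 k hk) (mul_nonneg (le_of_lt ht) h0)
    · have hlim : Tendsto (fun t : ℝ => laplacian p k + t * laplacian h k) (𝓝[>] 0)
          (𝓝 (laplacian p k + 0 * laplacian h k)) :=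
        (Continuous.tendsto (by fun_prop) 0).mono_left nhdsWithin_le_nhds
      rw [zero_mul, add_zero] at hlim
      exact (hlim.eventually_const_lt h0).mono fun _ => le_of_lt
  obtain ⟨t₀, ht₀, hsub⟩ := mem_nhdsGT_iff_exists_Ioc_subset.1 hev
  refine nonneg_of_quadratic_nonneg (b := 1 / 2 * ∑ k ∈ Finset.range N, h k ^ 2) ht₀
    fun t ht htt₀ => ?_
  have hmem : (fun j => p j + t * h j) ∈ convexClass := by
    refine ⟨hp.1.1.add ((memℓp_two_of_support hh).const_mul t), fun k hk => ?_⟩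
    rw [laplacian_add_mul]
    rcases lt_or_ge k (N + 1) with hkN | hkN
    · exact hsub ⟨ht, htt₀⟩ k (Finset.mem_range.2 hkN) hk
    · rw [laplacian_eq_zero_of_lt hh hkN, mul_zero, add_zero]
      exact hp.1.2 k hk
  have := hp.2 _ hmem
  rw [lsCriterion_add_mul hq hp.1.1 hh] at this
  linarith

/-! ### Exact localization of the estimator at a knot -/

lemma le_of_mem_breakpoints {p : ℕ → ℝ} {S k : ℕ} (hk : k ∈ breakpoints p S) : k ≤ S + 1 := by
  rcases hk with (rfl | rfl) | hk
  · omega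
  · exact le_rfl
  · exact hk.2.1.le

/-- A point left of the breakpoint `s` that is not itself a breakpoint lies in the interior of a
piece contained in `{0, …, s}`. -/
lemma exists_isPiece {p : ℕ → ℝ} {S s k : ℕ} (hs : s ∈ breakpoints p S) (hk : k < s)
    (hkb : k ∉ breakpoints p S) : ∃ a b, IsPiece p S a b ∧ b ≤ s ∧ a < k ∧ k < b := by
  classical
  have hex : ∃ b, k < b ∧ b ∈ breakpoints p S := ⟨s, hk, hs⟩
  have h0 : 0 ∈ breakpoints p S := Or.inl (Or.inl rfl)
  have hmem : Nat.findGreatest (· ∈ breakpoints p S) k ∈ breakpoints p S :=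
    Nat.findGreatest_spec (P := (· ∈ breakpoints p S)) (Nat.zero_le k) h0
  have hle := Nat.findGreatest_le (P := (· ∈ breakpoints p S)) k
  have hlt : Nat.findGreatest (· ∈ breakpoints p S) k < k :=
    lt_of_le_of_ne hle fun h => hkb (h ▸ hmem)
  refine ⟨_, Nat.find hex, ⟨hmem, (Nat.find_spec hex).2, hlt.trans (Nat.find_spec hex).1,
    fun c hac hcb hc => ?_⟩, Nat.find_min' hex ⟨hk, hs⟩, hlt, (Nat.find_spec hex).1⟩
  rcases lt_or_ge k c with hkc | hkc
  · exact Nat.find_min hex hcb ⟨hkc, hc⟩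
  · exact absurd (Nat.le_findGreatest (P := (· ∈ breakpoints p S)) hkc hc) (not_le.2 hac)

/-- Second differences of a vector in the left cone, written for a sequence that agrees with it
up to an additive constant. -/
lemma laplacian_nonneg_of_mem_leftCone {p : ℕ → ℝ} {S s k : ℕ} (hs : s ∈ breakpoints p S)
    {f : Fin (s + 1) → ℝ} (hf : f ∈ leftCone p S s) {h : ℕ → ℝ} {c : ℝ}
    (hh : ∀ j : Fin (s + 1), h j = f j - c) (hk : k < s) (hkb : k ∉ breakpoints p S) :
    0 ≤ laplacian h k := by
  obtain ⟨a, b, hab, hbs, hak, hkb'⟩ := exists_isPiece hs hk hkb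
  obtain ⟨j, rfl⟩ : ∃ j, k = j + 1 := ⟨k - 1, by omega⟩
  have h1 := hf a b hab hbs j (by omega) (by omega) (by omega)
  have e0 := hh ⟨j, by omega⟩
  have e1 := hh ⟨j + 1, by omega⟩
  have e2 := hh ⟨j + 2, by omega⟩
  simp only at e0 e1 e2
  simp only [laplacian, Nat.add_sub_cancel, add_assoc, Nat.reduceAdd, e0, e1, e2]
  linarith

/-- On each piece `p₀` is affine, so subtracting it preserves convexity there. -/
lemma mul_sub_mem_leftCone {p p₀ : ℕ → ℝ} (hp : IsConvexSeq p) {S : ℕ} (s : ℕ) {c : ℝ}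
    (hc : 0 ≤ c) : (fun k : Fin (s + 1) => c * (p k - p₀ k)) ∈ leftCone p₀ S s := by
  intro a b hab _ k hk h1 h2
  have hkb : k + 1 ∉ breakpoints p₀ S := hab.between _ (by omega) (by omega)
  have hbS := le_of_mem_breakpoints hab.right_mem
  have h3 : laplacian p₀ (k + 1) ≤ 0 := by
    by_contra h
    exact hkb (Or.inr ⟨by omega, by omega, not_le.1 h⟩)
  have h4 := hp (k + 1) (by omega)
  simp only [laplacian, Nat.add_sub_cancel] at h3 h4
  have h5 := mul_nonneg hc (sub_nonneg.2 (h3.trans h4))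
  simp only
  linarith

section Localization

variable {q p p₀ : ℕ → ℝ} {S s : ℕ}

/-- The indicator of `{0, …, s}` is a direction with no downward curvature except at `s`, so
the mass that the estimate puts on `{0, …, s}` is at least the empirical one. -/
lemma sum_le_sum_of_kink (hq : Memℓp q 2) (hp : IsMinimizer (lsCriterion q) convexClass p)
    (hkink : 0 < laplacian p s) : distFun q s ≤ distFun p s := by
  have h := sum_sub_mul_nonneg_of_isMinimizer hq hp (N := s + 1)
    (h := fun k => if k ≤ s then 1 else 0) (fun k hk => if_neg (by omega)) fun k hk => ?_
  · rw [← sub_nonneg, distFun, distFun, ← Finset.sum_sub_distrib]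
    refine h.trans_eq (Finset.sum_congr rfl fun k hk => ?_)
    rw [if_pos (by simpa [Nat.lt_succ_iff] using hk), mul_one]
  · rcases lt_trichotomy k s with hks | rfl | hks
    · left
      simp only [laplacian]
      rw [if_pos (by omega), if_pos hks.le, if_pos (by omega)]
      norm_num
    · exact Or.inr hkink
    · left
      simp only [laplacian]
      rw [if_neg (by omega), if_neg (by omega)]
      split_ifs <;> norm_num

/-- Directions supported on `{0, …, s}`, normalized to vanish at `s`. -/
lemma sum_sub_mul_sub_last_nonneg (hq : Memℓp q 2)
    (hp : IsMinimizer (lsCriterion q) convexClass p) (hkink : 0 < laplacian p s)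
    (f : ℕ → ℝ) (hdir : ∀ k, 1 ≤ k → k < s → 0 ≤ laplacian f k ∨ 0 < laplacian p k) :
    0 ≤ ∑ k : Fin (s + 1), (p k - q k) * (f k - f s) := by
  have h := sum_sub_mul_nonneg_of_isMinimizer hq hp (N := s + 1)
    (h := fun k => if k ≤ s then f k - f s else 0) (fun k hk => if_neg (by omega)) fun k hk => ?_
  · rw [Fin.sum_univ_eq_sum_range (fun k => (p k - q k) * (f k - f s))]
    refine h.trans_eq (Finset.sum_congr rfl fun k hk => ?_)
    rw [if_pos (by simpa [Nat.lt_succ_iff] using hk)]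
  · rcases lt_trichotomy k s with hks | rfl | hks
    · refine (hdir k hk hks).imp_left fun hf => ?_
      simp only [laplacian] at hf ⊢
      rw [if_pos (by omega), if_pos hks.le, if_pos (by omega)]
      linarith
    · exact Or.inr hkink
    · left
      simp only [laplacian]
      rw [if_neg (by omega), if_neg (by omega)]
      split_ifs with h
      · obtain rfl : k - 1 = s := by omega
        simp
      · norm_num

/-- If the estimate `p` has a kink at each knot of `p₀` up to `s`, then its rescaled error on
`{0, …, s}` is exactly the projection of the rescaled empirical error onto the left cone, once
the empirical error at `s` is corrected by the excess mass `c * (F_p(s) - F_q(s))`. The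
correction makes the residual orthogonal to constants; the cone modulo constants is then tested
by directions supported on `{0, …, s - 1}`. -/
lemma isMinimizer_rescaled (hq : Memℓp q 2) (hp : IsMinimizer (lsCriterion q) convexClass p)
    (hp₀ : IsConvexSeq p₀) (hs : s ∈ interiorKnots p₀ S)
    (hkink : ∀ k ∈ interiorKnots p₀ S, k ≤ s → 0 < laplacian p k) {c : ℝ} (hc : 0 ≤ c) :
    IsMinimizer (finCriterion fun k => c * (q k - p₀ k)
        + if k = s then c * (distFun p s - distFun q s) else 0) (leftCone p₀ S s)
      fun k => c * (p k - p₀ k) := by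
  have hsb : s ∈ breakpoints p₀ S := Or.inr hs
  -- The correction at `s` replaces the test vector `f` by `f - f s`, which vanishes at `s`.
  have hres : ∀ f : ℕ → ℝ, ∑ k : Fin (s + 1), (c * (p k - p₀ k) - (c * (q k - p₀ k)
      + if (k : ℕ) = s then c * (distFun p s - distFun q s) else 0)) * f k
      = c * ∑ k : Fin (s + 1), (p k - q k) * (f k - f s) := by
    intro f
    rw [Fin.sum_univ_eq_sum_range (fun k => (c * (p k - p₀ k) - (c * (q k - p₀ k)
      + if k = s then c * (distFun p s - distFun q s) else 0)) * f k),
      Fin.sum_univ_eq_sum_range (fun k => (p k - q k) * (f k - f s))]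
    have e1 : ∀ k, (c * (p k - p₀ k) - (c * (q k - p₀ k)
        + if k = s then c * (distFun p s - distFun q s) else 0)) * f k
        = c * ((p k - q k) * f k)
          - if k = s then c * (distFun p s - distFun q s) * f s else 0 := by
      intro k
      split_ifs with h
      · subst h; ring
      · ring
    have e2 : ∑ k ∈ Finset.range (s + 1), (p k - q k) * (f k - f s)
        = ∑ k ∈ Finset.range (s + 1), (p k - q k) * f k
          - (distFun p s - distFun q s) * f s := by
      rw [distFun, distFun, ← Finset.sum_sub_distrib, Finset.sum_mul, ← Finset.sum_sub_distrib]
      exact Finset.sum_congr rfl fun k _ => mul_sub _ _ _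
    rw [Finset.sum_congr rfl fun k _ => e1 k, Finset.sum_sub_distrib, Finset.sum_ite_eq',
      if_pos (Finset.self_mem_range_succ s), ← Finset.mul_sum, e2]
    ring
  refine (isClosedConvexCone_leftCone p₀ S s).isMinimizer_iff.2
    ⟨mul_sub_mem_leftCone hp.1.2 s hc, fun f hf => ?_, ?_⟩
  · have h1 := hres fun k => if h : k < s + 1 then f ⟨k, h⟩ else 0
    simp only [Fin.is_lt, dite_true, Fin.eta] at h1
    rw [h1]
    refine mul_nonneg hc ?_
    have h2 := sum_sub_mul_sub_last_nonneg hq hp (hkink s hs le_rfl)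
      (fun k => if h : k < s + 1 then f ⟨k, h⟩ else 0) fun k hk hks => ?_
    · simpa only [Fin.is_lt, dite_true, Fin.eta] using h2
    · by_cases hkb : k ∈ breakpoints p₀ S
      · refine Or.inr (hkink k ?_ hks.le)
        rcases hkb with (rfl | rfl) | hkb
        · omega
        · exact absurd hs.2.1 (by omega)
        · exact hkb
      · exact Or.inl (laplacian_nonneg_of_mem_leftCone hsb hf (c := 0)
          (fun j => by rw [dif_pos j.2, sub_zero]) hks hkb)
  -- The direction `-c * (p - p₀)` has curvature `c * (Δp₀ - Δp)`, which is nonnegative wherever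
  -- `p` has no kink.
  · have h1 := hres fun k => c * (p k - p₀ k)
    rw [h1]
    have h2 := sum_sub_mul_sub_last_nonneg hq hp (hkink s hs le_rfl)
      (fun k => -(c * (p k - p₀ k))) fun k hk hks => ?_
    · refine mul_nonpos_of_nonneg_of_nonpos hc (neg_nonneg.1 (h2.trans_eq ?_))
      rw [← Finset.sum_neg_distrib]
      exact Finset.sum_congr rfl fun k _ => by ring
    · have e : laplacian (fun k => -(c * (p k - p₀ k))) k
          = c * (laplacian p₀ k - laplacian p k) := by
        simp only [laplacian]
        ring
      rcases (hp.1.2 k hk).eq_or_lt with h0 | h0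
      · left
        rw [e, ← h0, sub_zero]
        exact mul_nonneg hc (hp₀ k hk)
      · exact Or.inr h0

end Localization

/-- The estimate is at least as close to `q` as any other convex sequence. -/
lemma abs_sub_le_of_isMinimizer {q p p₀ : ℕ → ℝ} (hq : Memℓp q 2)
    (hp : IsMinimizer (lsCriterion q) convexClass p) (hp₀ : p₀ ∈ convexClass) (j : ℕ) :
    |p j - q j| ≤ √(∑' k, (q k - p₀ k) ^ 2) := by
  refine Real.abs_le_sqrt ?_
  have h1 : (q j - p j) ^ 2 ≤ ∑' k, (q k - p k) ^ 2 :=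
    (summable_sq_sub hq hp.1.1).le_tsum j fun k _ => sq_nonneg _
  have h2 := hp.2 _ hp₀
  simp only [lsCriterion] at h2
  have h3 : (p j - q j) ^ 2 = (q j - p j) ^ 2 := by ring
  linarith

/-! ### Multivariate central limit theorem -/

section CramerWold

variable {Ω Ω' ι : Type*} [Fintype ι] [MeasurableSpace Ω] [MeasurableSpace Ω']

lemma charFun_map_toLp {P : Measure Ω} {Y : Ω → ι → ℝ} (hY : AEMeasurable Y P)
    (t : EuclideanSpace ℝ ι) :
    charFun (P.map fun ω => WithLp.toLp 2 (Y ω)) t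
      = charFun (P.map fun ω => ∑ k, t k * Y ω k) 1 := by
  have h1 : AEMeasurable (fun ω => WithLp.toLp 2 (Y ω)) P := by fun_prop
  have h2 : AEMeasurable (fun ω => ∑ k, t k * Y ω k) P := by fun_prop
  rw [charFun_apply, charFun_apply, integral_map h1 (by fun_prop), integral_map h2 (by fun_prop)]
  refine integral_congr_ae (ae_of_all _ fun ω => ?_)
  simp [PiLp.inner_apply]

variable {P : Measure Ω} [IsProbabilityMeasure P] {Q : Measure Ω'} [IsProbabilityMeasure Q]

/-- The **Cramér–Wold device**: convergence in distribution of random vectors follows from that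
of their linear combinations. -/
lemma tendstoInDistribution_of_forall_sum_mul {Y : ℕ → Ω → ι → ℝ} {Z : Ω' → ι → ℝ}
    (hY : ∀ n, AEMeasurable (Y n) P) (hZ : AEMeasurable Z Q)
    (h : ∀ t : ι → ℝ, TendstoInDistribution (fun n ω => ∑ k, t k * Y n ω k) atTop
      (fun ω => ∑ k, t k * Z ω k) (fun _ => P) Q) :
    TendstoInDistribution Y atTop Z (fun _ => P) Q := by
  have hE : TendstoInDistribution (fun n ω => WithLp.toLp 2 (Y n ω)) atTop
      (fun ω => WithLp.toLp 2 (Z ω)) (fun _ => P) Q := by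
    refine ⟨fun n => by fun_prop, by fun_prop, ?_⟩
    refine ProbabilityMeasure.tendsto_iff_tendsto_charFun.2 fun t => ?_
    have ht := ProbabilityMeasure.tendsto_iff_tendsto_charFun.1 (h t.ofLp).tendsto 1
    simpa only [ProbabilityMeasure.coe_mk, charFun_map_toLp (hY _), charFun_map_toLp hZ] using ht
  exact hE.continuous_comp (g := WithLp.ofLp) (PiLp.continuous_ofLp 2 _)

/-- The multivariate **central limit theorem**, the Gaussian limit being described by the laws of
its linear combinations. -/
lemma tendstoInDistribution_pi_inv_sqrt_mul_sum_sub {V : ℕ → Ω → ι → ℝ} {Z : Ω' → ι → ℝ}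
    (hV : ∀ k, MemLp (fun ω => V 0 ω k) 2 P) (hindep : iIndepFun V P)
    (hident : ∀ i, IdentDistrib (V i) (V 0) P P)
    (hZm : AEMeasurable Z Q)
    (hZ : ∀ t : ι → ℝ, HasLaw (fun ω => ∑ k, t k * Z ω k)
      (gaussianReal 0 Var[fun ω => ∑ k, t k * V 0 ω k; P].toNNReal) Q) :
    TendstoInDistribution
      (fun (n : ℕ) ω k => (√n)⁻¹ * (∑ i ∈ Finset.range n, V i ω k - n * ∫ ω, V 0 ω k ∂P))
      atTop Z (fun _ => P) Q := by
  have hVm : ∀ i, AEMeasurable (V i) P := fun i => (hident i).aemeasurable_fst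
  refine tendstoInDistribution_of_forall_sum_mul (fun n => by fun_prop) hZm fun t => ?_
  have hcomp : Measurable fun v : ι → ℝ => ∑ k, t k * v k := by fun_prop
  have hclt := tendstoInDistribution_inv_sqrt_mul_sum_sub (P := P)
    (X := fun i ω => ∑ k, t k * V i ω k) (hZ t)
    (memLp_finsetSum _ fun k _ => (hV k).const_mul (t k))
    (hindep.comp (fun _ v => ∑ k, t k * v k) fun _ => hcomp)
    fun i => (hident i).comp hcomp
  convert hclt using 3 with n ω
  rw [integral_finsetSum _ fun k _ => ((hV k).integrable one_le_two).const_mul (t k)]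
  simp only [integral_const_mul, Finset.mul_sum, mul_sub, Finset.sum_sub_distrib]
  congr 1
  · rw [Finset.sum_comm]
    exact Finset.sum_congr rfl fun i _ => Finset.sum_congr rfl fun k _ => by ring
  · exact Finset.sum_congr rfl fun k _ => by ring

end CramerWold

/-! ### The order of two sequences with the same limit in distribution -/

/-- Truncation of a real number at levels `-M` and `M`. -/
def clamp (M x : ℝ) : ℝ := max (-M) (min M x)

lemma abs_clamp_le {M : ℝ} (hM : 0 ≤ M) (x : ℝ) : |clamp M x| ≤ M :=
  abs_le.2 ⟨le_max_left _ _, max_le (by linarith) (min_le_left _ _)⟩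

lemma clamp_mono (M : ℝ) : Monotone (clamp M) := fun _ _ h =>
  max_le_max le_rfl (min_le_min le_rfl h)

lemma clamp_of_abs_le {M x : ℝ} (h : |x| ≤ M) : clamp M x = x := by
  rw [clamp, min_eq_right (abs_le.1 h).2, max_eq_right (abs_le.1 h).1]

lemma continuous_clamp (M : ℝ) : Continuous (clamp M) := by
  unfold clamp
  fun_prop

section Order

variable {Ω Ω' : Type*} [MeasurableSpace Ω] [MeasurableSpace Ω']
  {P : Measure Ω} [IsProbabilityMeasure P] {Q : Measure Ω'} [IsProbabilityMeasure Q]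

lemma TendstoInDistribution.tendsto_integral_clamp {A : ℕ → Ω → ℝ} {V : Ω' → ℝ}
    (h : TendstoInDistribution A atTop V (fun _ => P) Q) {M : ℝ} (hM : 0 ≤ M) :
    Tendsto (fun n => ∫ ω, clamp M (A n ω) ∂P) atTop (𝓝 (∫ ω, clamp M (V ω) ∂Q)) := by
  have h1 := ProbabilityMeasure.tendsto_iff_forall_integral_tendsto.1 h.tendsto
    (BoundedContinuousFunction.ofNormedAddCommGroup (clamp M) (continuous_clamp M) M
      fun x => abs_clamp_le hM x)
  simp only [ProbabilityMeasure.coe_mk, BoundedContinuousFunction.coe_ofNormedAddCommGroup] at h1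
  rw [integral_map h.aemeasurable_limit (continuous_clamp M).aestronglyMeasurable] at h1
  refine h1.congr fun n => ?_
  rw [integral_map (h.forall_aemeasurable n) (continuous_clamp M).aestronglyMeasurable]

/-- A sequence that converges in distribution is bounded in probability. -/
lemma TendstoInDistribution.exists_eventually_measure_le_abs_lt {A : ℕ → Ω → ℝ} {V : Ω' → ℝ}
    (h : TendstoInDistribution A atTop V (fun _ => P) Q) {δ : ENNReal} (hδ : 0 < δ) :
    ∃ M : ℝ, 0 ≤ M ∧ ∀ᶠ n in atTop, P {ω | M ≤ |A n ω|} < δ := by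
  have hlim : Tendsto (fun m : ℕ => Q.map V {x | (m : ℝ) ≤ |x|}) atTop (𝓝 0) := by
    have := tendsto_measure_iInter_atTop (μ := Q.map V) (s := fun m : ℕ => {x : ℝ | (m : ℝ) ≤ |x|})
      (fun m => (measurableSet_le measurable_const measurable_norm).nullMeasurableSet)
      (fun m m' hm x hx => by
        simp only [Set.mem_ofPred_eq] at hx ⊢
        exact (Nat.cast_le.2 hm).trans hx)
      ⟨0, by
        have := Measure.isProbabilityMeasure_map h.aemeasurable_limit
        exact measure_ne_top _ _⟩
    have hempty : ⋂ m : ℕ, {x : ℝ | (m : ℝ) ≤ |x|} = ∅ := by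
      ext x
      simpa using exists_nat_gt |x|
    rwa [hempty, measure_empty] at this
  obtain ⟨m, hm⟩ := (hlim.eventually_lt_const hδ).exists
  have hclosed : IsClosed {x : ℝ | (m : ℝ) ≤ |x|} := isClosed_le continuous_const continuous_abs
  have hls := ProbabilityMeasure.limsup_measure_closed_le_of_tendsto h.tendsto hclosed
  refine ⟨m, Nat.cast_nonneg m, ?_⟩
  filter_upwards [Filter.eventually_lt_of_limsup_lt (lt_of_le_of_lt hls hm)] with n hn
  simp only [ProbabilityMeasure.coe_mk] at hn
  rwa [Measure.map_apply_of_aemeasurable (h.forall_aemeasurable n) hclosed.measurableSet] at hn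

/-- Two sequences with the same limit in distribution, one of which eventually dominates the
other, are asymptotically equal in probability: the truncated differences are asymptotically
nonnegative and have mean tending to zero. -/
lemma tendstoInMeasure_sub_of_le {A B : ℕ → Ω → ℝ} {V : Ω' → ℝ}
    (hA : TendstoInDistribution A atTop V (fun _ => P) Q)
    (hB : TendstoInDistribution B atTop V (fun _ => P) Q)
    (hle : ∀ᵐ ω ∂P, ∀ᶠ n in atTop, B n ω ≤ A n ω) :
    TendstoInMeasure P (fun n ω => A n ω - B n ω) atTop (fun _ => 0) := by
  have hAm := hA.forall_aemeasurable
  have hBm := hB.forall_aemeasurable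
  -- The truncated difference tends to zero in `L¹`.
  have hL1 : ∀ M : ℝ, 0 ≤ M →
      Tendsto (fun n => ∫ ω, |clamp M (A n ω) - clamp M (B n ω)| ∂P) atTop (𝓝 0) := by
    intro M hM
    have hcA : ∀ n, AEStronglyMeasurable (fun ω => clamp M (A n ω)) P := fun n =>
      ((continuous_clamp M).measurable.comp_aemeasurable (hAm n)).aestronglyMeasurable
    have hcB : ∀ n, AEStronglyMeasurable (fun ω => clamp M (B n ω)) P := fun n =>
      ((continuous_clamp M).measurable.comp_aemeasurable (hBm n)).aestronglyMeasurable
    have hiA : ∀ n, Integrable (fun ω => clamp M (A n ω)) P := fun n =>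
      Integrable.of_bound (hcA n) M (ae_of_all _ fun ω => abs_clamp_le hM _)
    have hiB : ∀ n, Integrable (fun ω => clamp M (B n ω)) P := fun n =>
      Integrable.of_bound (hcB n) M (ae_of_all _ fun ω => abs_clamp_le hM _)
    have hmean : Tendsto (fun n => ∫ ω, (clamp M (A n ω) - clamp M (B n ω)) ∂P) atTop (𝓝 0) := by
      have h := (TendstoInDistribution.tendsto_integral_clamp hA hM).sub
        (TendstoInDistribution.tendsto_integral_clamp hB hM)
      rw [sub_self] at h
      exact h.congr fun n => (integral_sub (hiA n) (hiB n)).symm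
    -- Twice the negative part vanishes eventually, almost surely.
    have hneg : Tendsto (fun n => ∫ ω, (|clamp M (A n ω) - clamp M (B n ω)|
        - (clamp M (A n ω) - clamp M (B n ω))) ∂P) atTop (𝓝 0) := by
      rw [← integral_zero Ω ℝ (μ := P)]
      refine tendsto_integral_of_dominated_convergence (fun _ => 4 * M) (fun n => ?_)
        (integrable_const _) (fun n => ae_of_all _ fun ω => ?_) ?_
      · exact ((hcA n).sub (hcB n)).norm.sub ((hcA n).sub (hcB n))
      · have h1 := abs_le.1 (abs_clamp_le hM (A n ω))
        have h2 := abs_le.1 (abs_clamp_le hM (B n ω))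
        rw [Real.norm_eq_abs, abs_le]
        rcases abs_cases (clamp M (A n ω) - clamp M (B n ω)) with h | h <;>
          constructor <;> linarith
      · filter_upwards [hle] with ω hω
        refine tendsto_const_nhds.congr' ?_
        filter_upwards [hω] with n hn
        rw [abs_of_nonneg (sub_nonneg.2 (clamp_mono M hn)), sub_self]
    have h := hmean.add hneg
    rw [add_zero] at h
    refine h.congr fun n => ?_
    have hi : Integrable (fun ω => clamp M (A n ω) - clamp M (B n ω)) P := (hiA n).sub (hiB n)
    have hi' : Integrable (fun ω => |clamp M (A n ω) - clamp M (B n ω)|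
        - (clamp M (A n ω) - clamp M (B n ω))) P := hi.abs.sub hi
    rw [← integral_add hi hi']
    exact integral_congr_ae (ae_of_all _ fun ω => by simp)
  refine tendstoInMeasure_iff_norm.2 fun ε hε => ?_
  refine ENNReal.tendsto_atTop_zero.2 fun δ hδ => ?_
  have hδ3 : 0 < δ / 3 := ENNReal.div_pos hδ.ne' (by norm_num)
  obtain ⟨M₁, hM₁, h1⟩ := TendstoInDistribution.exists_eventually_measure_le_abs_lt hA hδ3
  obtain ⟨M₂, hM₂, h2⟩ := TendstoInDistribution.exists_eventually_measure_le_abs_lt hB hδ3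
  have hM : 0 ≤ max M₁ M₂ := le_max_of_le_left hM₁
  -- Markov's inequality for the truncated difference.
  have h3 : ∀ᶠ n in atTop,
      P {ω | ε ≤ |clamp (max M₁ M₂) (A n ω) - clamp (max M₁ M₂) (B n ω)|} < δ / 3 := by
    have hcl : ∀ n, AEStronglyMeasurable
        (fun ω => clamp (max M₁ M₂) (A n ω) - clamp (max M₁ M₂) (B n ω)) P := fun n =>
      (((continuous_clamp _).measurable.comp_aemeasurable (hAm n)).sub
        ((continuous_clamp _).measurable.comp_aemeasurable (hBm n))).aestronglyMeasurable
    have hmeas : TendstoInMeasure P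
        (fun n ω => clamp (max M₁ M₂) (A n ω) - clamp (max M₁ M₂) (B n ω)) atTop (fun _ => 0) := by
      refine tendstoInMeasure_of_tendsto_eLpNorm (p := 1) one_ne_zero hcl
        aestronglyMeasurable_const ?_
      have hi : ∀ n, Integrable
          (fun ω => clamp (max M₁ M₂) (A n ω) - clamp (max M₁ M₂) (B n ω)) P := fun n =>
        Integrable.of_bound (hcl n) (max M₁ M₂ + max M₁ M₂) (ae_of_all _ fun ω =>
          (norm_sub_le _ _).trans (add_le_add (abs_clamp_le hM _) (abs_clamp_le hM _)))
      have h0 := ENNReal.tendsto_ofReal (hL1 _ hM)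
      rw [ENNReal.ofReal_zero] at h0
      refine h0.congr fun n => ?_
      rw [← Pi.zero_def, sub_zero, eLpNorm_one_eq_lintegral_enorm,
        ← ofReal_integral_norm_eq_lintegral_enorm (hi n)]
      rfl
    have := tendstoInMeasure_iff_norm.1 hmeas ε hε
    simp only [sub_zero, Real.norm_eq_abs] at this
    exact this.eventually_lt_const hδ3
  obtain ⟨n₀, hn₀⟩ := eventually_atTop.1 (h1.and (h2.and h3))
  refine ⟨n₀, fun n hn => ?_⟩
  obtain ⟨e1, e2, e3⟩ := hn₀ n hn
  have hsub : {ω | ε ≤ ‖A n ω - B n ω - 0‖} ⊆ {ω | M₁ ≤ |A n ω|} ∪ {ω | M₂ ≤ |B n ω|}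
      ∪ {ω | ε ≤ |clamp (max M₁ M₂) (A n ω) - clamp (max M₁ M₂) (B n ω)|} := by
    intro ω hω
    simp only [sub_zero, Real.norm_eq_abs, Set.mem_ofPred_eq] at hω
    by_contra hcon
    simp only [Set.mem_union, Set.mem_ofPred_eq, not_or, not_le] at hcon
    obtain ⟨⟨hc1, hc2⟩, hc3⟩ := hcon
    rw [clamp_of_abs_le (hc1.le.trans (le_max_left _ _)),
      clamp_of_abs_le (hc2.le.trans (le_max_right _ _))] at hc3
    exact absurd hω (not_le.2 hc3)
  calc P {ω | ε ≤ ‖A n ω - B n ω - 0‖} ≤ _ := measure_mono hsub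
    _ ≤ _ := measure_union_le _ _
    _ ≤ _ := add_le_add_left (measure_union_le _ _) _
    _ ≤ δ / 3 + δ / 3 + δ / 3 := by gcongr
    _ = δ := ENNReal.add_thirds δ

end Order

/-! ### The empirical pmf -/

section Empirical

variable {Ω : Type*} [MeasurableSpace Ω] {P : Measure Ω} {p₀ : ℕ → ℝ}
  {X : ℕ → Ω → ℕ} {S : ℕ}

/-- Every function of the empirical pmf is measurable, since the sample takes countably many
values; in particular the least squares estimator is measurable. -/
lemma measurable_comp_empiricalPMF {β : Type*} [MeasurableSpace β] (hX : ∀ i, Measurable (X i))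
    (G : (ℕ → ℝ) → β) (n : ℕ) : Measurable fun ω => G (empiricalPMF X n ω) := by
  have h1 : Measurable fun v : Fin n → ℕ =>
      G fun j => (1 / (n : ℝ)) * ∑ i : Fin n, if v i = j then 1 else 0 :=
    measurable_of_countable _
  have h2 : Measurable fun ω (i : Fin n) => X i ω := measurable_pi_lambda _ fun i => hX i
  convert h1.comp h2 using 1
  funext ω
  simp only [Function.comp_apply]
  congr 1
  funext j
  rw [empiricalPMF, ← Fin.sum_univ_eq_sum_range (fun i => if X i ω = j then (1 : ℝ) else 0)]

lemma integral_ite_eq (hX : ∀ i, Measurable (X i))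
    (hlaw : ∀ i k, P.real {ω | X i ω = k} = p₀ k) (k : ℕ) :
    ∫ ω, (if X 0 ω = k then (1 : ℝ) else 0) ∂P = p₀ k := by
  have hmeas : MeasurableSet {ω | X 0 ω = k} := hX 0 (measurableSet_singleton k)
  rw [← hlaw 0 k, ← integral_indicator_one hmeas]
  refine integral_congr_ae (ae_of_all _ fun ω => ?_)
  simp [Set.indicator_apply]

variable [IsProbabilityMeasure P]

lemma identDistrib_of_pmf (hX : ∀ i, Measurable (X i))
    (hlaw : ∀ i k, P.real {ω | X i ω = k} = p₀ k) (i : ℕ) : IdentDistrib (X i) (X 0) P P := by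
  refine ⟨(hX i).aemeasurable, (hX 0).aemeasurable, Measure.ext_of_singleton fun k => ?_⟩
  rw [Measure.map_apply (hX i) (measurableSet_singleton k),
    Measure.map_apply (hX 0) (measurableSet_singleton k),
    ← measureReal_eq_measureReal_iff]
  exact (hlaw i k).trans (hlaw 0 k).symm

lemma memLp_ite_eq {Y : Ω → ℕ} (hY : Measurable Y) (k : ℕ) :
    MemLp (fun ω => if Y ω = k then (1 : ℝ) else 0) 2 P :=
  MemLp.of_bound ((measurable_from_nat (f := fun j => if j = k then (1 : ℝ) else 0)).comp
    hY).aestronglyMeasurable 1 (ae_of_all _ fun ω => by split_ifs <;> simp)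

/-- The multinomial covariances. -/
lemma covariance_ite_eq (hX : ∀ i, Measurable (X i))
    (hlaw : ∀ i k, P.real {ω | X i ω = k} = p₀ k) (j k : ℕ) :
    covariance (fun ω => if X 0 ω = j then (1 : ℝ) else 0)
        (fun ω => if X 0 ω = k then (1 : ℝ) else 0) P
      = (if j = k then p₀ j else 0) - p₀ j * p₀ k := by
  rw [covariance_eq_sub (memLp_ite_eq (hX 0) j) (memLp_ite_eq (hX 0) k),
    integral_ite_eq hX hlaw, integral_ite_eq hX hlaw]
  congr 1
  split_ifs with h
  · subst h
    rw [← integral_ite_eq hX hlaw j]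
    refine integral_congr_ae (ae_of_all _ fun ω => ?_)
    simp
  · rw [← integral_zero Ω ℝ (μ := P)]
    refine integral_congr_ae (ae_of_all _ fun ω => ?_)
    by_cases hj : X 0 ω = j
    · simp [hj, h]
    · simp [hj]

/-- The strong law of large numbers for the empirical pmf. -/
lemma ae_tendsto_empiricalPMF (hX : ∀ i, Measurable (X i)) (hindep : iIndepFun X P)
    (hlaw : ∀ i k, P.real {ω | X i ω = k} = p₀ k) :
    ∀ᵐ ω ∂P, ∀ k, Tendsto (fun n => empiricalPMF X n ω k) atTop (𝓝 (p₀ k)) := by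
  refine ae_all_iff.2 fun k => ?_
  have hf : Measurable fun j : ℕ => if j = k then (1 : ℝ) else 0 := measurable_from_nat
  have h := strong_law_ae_real (fun i ω => if X i ω = k then (1 : ℝ) else 0)
    ((memLp_ite_eq (hX 0) k).integrable one_le_two)
    (fun i j hij => (hindep.indepFun hij).comp hf hf)
    fun i => (identDistrib_of_pmf hX hlaw i).comp hf
  rw [integral_ite_eq hX hlaw] at h
  filter_upwards [h] with ω hω
  refine hω.congr fun n => ?_
  rw [empiricalPMF]
  ring

lemma ae_forall_le (hlaw : ∀ i k, P.real {ω | X i ω = k} = p₀ k)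
    (hS : ∀ k, S + 1 ≤ k → p₀ k = 0) : ∀ᵐ ω ∂P, ∀ i, X i ω ≤ S := by
  refine ae_all_iff.2 fun i => ?_
  have h : ∀ᵐ ω ∂P, ∀ k, S + 1 ≤ k → X i ω ≠ k := by
    refine ae_all_iff.2 fun k => ?_
    by_cases hk : S + 1 ≤ k
    · have h0 : P {ω | X i ω = k} = 0 := by
        rw [← measureReal_eq_zero_iff, hlaw, hS k hk]
      have h1 : ∀ᵐ ω ∂P, X i ω ≠ k := by
        rw [ae_iff]
        simpa using h0
      exact h1.mono fun ω hω _ => hω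
    · exact ae_of_all _ fun ω h => absurd h hk
  filter_upwards [h] with ω hω
  by_contra hcon
  exact hω _ (by omega) rfl

/-- Strong consistency of the least squares estimator. -/
lemma ae_tendsto_lse (hX : ∀ i, Measurable (X i)) (hindep : iIndepFun X P)
    (hlaw : ∀ i k, P.real {ω | X i ω = k} = p₀ k) (hconv : IsConvexSeq p₀)
    (hS : ∀ k, S + 1 ≤ k → p₀ k = 0) :
    ∀ᵐ ω ∂P, ∀ k, Tendsto (fun n => lse X n ω k) atTop (𝓝 (p₀ k)) := by
  filter_upwards [ae_tendsto_empiricalPMF hX hindep hlaw, ae_forall_le hlaw hS] with ω hlim hle k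
  have hzero : ∀ n j, j ∉ Finset.range (S + 1) → (empiricalPMF X n ω j - p₀ j) ^ 2 = 0 := by
    intro n j hj
    rw [Finset.mem_range, not_lt] at hj
    rw [hS j hj, empiricalPMF, Finset.sum_eq_zero fun i _ => if_neg ?_]
    · simp
    · have := hle i
      omega
  have hdist : Tendsto (fun n => √(∑' j, (empiricalPMF X n ω j - p₀ j) ^ 2)) atTop (𝓝 0) := by
    have h1 : Tendsto (fun n => ∑ j ∈ Finset.range (S + 1), (empiricalPMF X n ω j - p₀ j) ^ 2)
        atTop (𝓝 (∑ j ∈ Finset.range (S + 1), (p₀ j - p₀ j) ^ 2)) :=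
      tendsto_finsetSum _ fun j _ => ((hlim j).sub_const _).pow 2
    have h2 := (Real.continuous_sqrt.tendsto _).comp h1
    simp only [sub_self, ne_eq, OfNat.ofNat_ne_zero, not_false_eq_true, zero_pow,
      Finset.sum_const_zero, Real.sqrt_zero] at h2
    refine h2.congr fun n => ?_
    rw [Function.comp_apply, tsum_eq_sum (hzero n)]
  have hdiff : Tendsto (fun n => lse X n ω k - empiricalPMF X n ω k) atTop (𝓝 0) :=
    squeeze_zero_norm (fun n => abs_sub_le_of_isMinimizer (memℓp_empiricalPMF X n ω)
      (lse_isMinimizer X n ω) ⟨memℓp_two_of_support hS, hconv⟩ k) hdist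
  simpa using hdiff.add (hlim k)

/-- Eventually the estimator has a kink at every knot of `p₀`. -/
lemma ae_eventually_laplacian_lse_pos (hX : ∀ i, Measurable (X i)) (hindep : iIndepFun X P)
    (hlaw : ∀ i k, P.real {ω | X i ω = k} = p₀ k) (hconv : IsConvexSeq p₀)
    (hS : ∀ k, S + 1 ≤ k → p₀ k = 0) :
    ∀ᵐ ω ∂P, ∀ᶠ n in atTop, ∀ k ∈ interiorKnots p₀ S, 0 < laplacian (lse X n ω) k := by
  filter_upwards [ae_tendsto_lse hX hindep hlaw hconv hS] with ω hω
  have h : ∀ᶠ n in atTop, ∀ k ∈ Finset.range (S + 1), k ∈ interiorKnots p₀ S →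
      0 < laplacian (lse X n ω) k := by
    refine (Filter.eventually_all_finset _).2 fun k _ => ?_
    rw [eventually_imp_distrib_left]
    intro hk
    have hlim : Tendsto (fun n => laplacian (lse X n ω) k) atTop (𝓝 (laplacian p₀ k)) :=
      ((hω (k + 1)).sub ((hω k).const_mul 2)).add (hω (k - 1))
    exact hlim.eventually_const_lt hk.2.2
  exact h.mono fun n hn k hk => hn k (Finset.mem_range.2 hk.2.1) hk

end Empirical

/-! ### Increments of the Brownian bridge -/

section Bridge

variable {Ω' : Type*} {p₀ : ℕ → ℝ}

lemma IsPMF.sum_range_mem_Icc (hp : IsPMF p₀) (k : ℕ) :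
    ∑ j ∈ Finset.range k, p₀ j ∈ Set.Icc (0 : ℝ) 1 :=
  ⟨Finset.sum_nonneg fun j _ => hp.nonneg j,
    sum_le_hasSum _ (fun j _ => hp.nonneg j) hp.hasSum_one⟩

lemma IsPMF.sum_range_mono (hp : IsPMF p₀) : Monotone fun k => ∑ j ∈ Finset.range k, p₀ j :=
  monotone_nat_of_le_succ fun k => by
    rw [Finset.sum_range_succ]
    linarith [hp.nonneg k]

lemma increment_eq (U : ℝ → Ω' → ℝ) (p₀ : ℕ → ℝ) (ω : Ω') (k : ℕ) :
    increment U p₀ ω k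
      = U (∑ j ∈ Finset.range (k + 1), p₀ j) ω - U (∑ j ∈ Finset.range k, p₀ j) ω := by
  cases k <;> simp [increment, distFun]

variable [MeasurableSpace Ω'] {Q : Measure Ω'} {U : ℝ → Ω' → ℝ}

lemma IsBrownianBridge.memLp (hU : IsBrownianBridge U Q) {t : ℝ} (ht : t ∈ Set.Icc (0 : ℝ) 1) :
    MemLp (U t) 2 Q :=
  (hU.gaussian.hasGaussianLaw_eval ⟨t, ht⟩).memLp_two

lemma IsBrownianBridge.hasGaussianLaw_increment (hU : IsBrownianBridge U Q) (hp : IsPMF p₀)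
    (N : ℕ) : HasGaussianLaw (fun ω (k : Fin N) => increment U p₀ ω k) Q := by
  have h := hU.gaussian.hasGaussianLaw_increments (n := N)
    (t := fun i => ⟨∑ j ∈ Finset.range i, p₀ j, hp.sum_range_mem_Icc i⟩)
  simpa only [increment_eq, Fin.val_succ, Fin.val_castSucc] using h

lemma IsBrownianBridge.memLp_increment (hU : IsBrownianBridge U Q) (hp : IsPMF p₀) (k : ℕ) :
    MemLp (fun ω => increment U p₀ ω k) 2 Q := by
  simp only [increment_eq]
  exact (hU.memLp (hp.sum_range_mem_Icc _)).sub (hU.memLp (hp.sum_range_mem_Icc _))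

variable [IsProbabilityMeasure Q]

lemma IsBrownianBridge.integral_increment (hU : IsBrownianBridge U Q) (hp : IsPMF p₀) (k : ℕ) :
    ∫ ω, increment U p₀ ω k ∂Q = 0 := by
  simp only [increment_eq]
  rw [integral_sub ((hU.memLp (hp.sum_range_mem_Icc _)).integrable one_le_two)
    ((hU.memLp (hp.sum_range_mem_Icc _)).integrable one_le_two),
    hU.mean _ (hp.sum_range_mem_Icc _), hU.mean _ (hp.sum_range_mem_Icc _), sub_zero]

/-- The increments of the bridge have the covariances of a multinomial vector. -/
lemma IsBrownianBridge.covariance_increment (hU : IsBrownianBridge U Q) (hp : IsPMF p₀)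
    (j k : ℕ) :
    covariance (fun ω => increment U p₀ ω j) (fun ω => increment U p₀ ω k) Q
      = (if j = k then p₀ j else 0) - p₀ j * p₀ k := by
  simp only [increment_eq]
  have hI := hp.sum_range_mem_Icc
  have hmono := hp.sum_range_mono
  rw [covariance_fun_sub_fun_sub (hU.memLp (hI _)) (hU.memLp (hI _)) (hU.memLp (hI _))
    (hU.memLp (hI _)), hU.cov _ (hI _) _ (hI _), hU.cov _ (hI _) _ (hI _), hU.cov _ (hI _) _ (hI _),
    hU.cov _ (hI _) _ (hI _)]
  have hj := Finset.sum_range_succ p₀ j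
  have hk := Finset.sum_range_succ p₀ k
  rcases lt_trichotomy j k with h | rfl | h
  · have h1 : ∑ i ∈ Finset.range (j + 1), p₀ i ≤ ∑ i ∈ Finset.range k, p₀ i := hmono h
    have h2 := hp.nonneg j
    have h3 := hp.nonneg k
    rw [if_neg h.ne, min_eq_left (by linarith), min_eq_left h1, min_eq_left (by linarith),
      min_eq_left (by linarith), hj, hk]
    ring
  · have h2 := hp.nonneg j
    rw [if_pos rfl, min_self, min_self, min_eq_right (by linarith), min_eq_left (by linarith), hj]
    ring
  · have h1 : ∑ i ∈ Finset.range (k + 1), p₀ i ≤ ∑ i ∈ Finset.range j, p₀ i := hmono h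
    have h2 := hp.nonneg j
    have h3 := hp.nonneg k
    rw [if_neg h.ne', min_eq_right (by linarith), min_eq_right (by linarith), min_eq_right h1,
      min_eq_right (by linarith), hj, hk]
    ring

end Bridge

/-! ### The limit of the empirical process -/

lemma variance_sum_mul {Ω : Type*} [MeasurableSpace Ω] {P : Measure Ω}
    [IsProbabilityMeasure P] {ι : Type*} [Fintype ι] {V : ι → Ω → ℝ} (hV : ∀ k, MemLp (V k) 2 P)
    (t : ι → ℝ) :
    Var[fun ω => ∑ k, t k * V k ω; P] = ∑ j, ∑ k, t k * (t j * covariance (V j) (V k) P) := by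
  have h : ∀ k, MemLp (fun ω => t k * V k ω) 2 P := fun k => (hV k).const_mul (t k)
  rw [← covariance_self (memLp_finsetSum _ fun k _ => h k).aemeasurable,
    covariance_fun_sum_fun_sum h h]
  simp only [covariance_const_mul_left, covariance_const_mul_right]

/-- The rescaled empirical error converges in distribution to the increments of the bridge. -/
lemma tendstoInDistribution_empiricalPMF {Ω Ω' : Type*} [MeasurableSpace Ω] [MeasurableSpace Ω']
    {P : Measure Ω} [IsProbabilityMeasure P] {Q : Measure Ω'} [IsProbabilityMeasure Q]
    {p₀ : ℕ → ℝ} (hpmf : IsPMF p₀) {X : ℕ → Ω → ℕ} (hX : ∀ i, Measurable (X i))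
    (hindep : iIndepFun X P) (hlaw : ∀ i k, P.real {ω | X i ω = k} = p₀ k)
    {U : ℝ → Ω' → ℝ} (hU : IsBrownianBridge U Q) (N : ℕ) :
    TendstoInDistribution
      (fun (n : ℕ) ω (k : Fin N) => √(n : ℝ) * (empiricalPMF X n ω k - p₀ k)) atTop
      (fun ω k => increment U p₀ ω k) (fun _ => P) Q := by
  have hf : Measurable fun (j : ℕ) (k : Fin N) => if j = (k : ℕ) then (1 : ℝ) else 0 :=
    measurable_from_nat
  have hG := hU.hasGaussianLaw_increment hpmf N
  have h := tendstoInDistribution_pi_inv_sqrt_mul_sum_sub (P := P) (Q := Q)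
    (V := fun i ω (k : Fin N) => if X i ω = (k : ℕ) then (1 : ℝ) else 0)
    (Z := fun ω k => increment U p₀ ω k)
    (fun k => memLp_ite_eq (hX 0) k) (hindep.comp (fun _ => _) fun _ => hf)
    (fun i => (identDistrib_of_pmf hX hlaw i).comp hf) hG.aemeasurable fun t => ?_
  · convert h using 4 with n ω k
    rw [integral_ite_eq hX hlaw, empiricalPMF, mul_sub, mul_sub, ← mul_assoc, ← mul_assoc]
    rcases Nat.eq_zero_or_pos n with rfl | hn
    · simp
    · have hn' : (0 : ℝ) < n := Nat.cast_pos.2 hn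
      have h1 : √(n : ℝ) * (1 / n) = (√(n : ℝ))⁻¹ := by
        rw [mul_one_div, Real.sqrt_div_self]
      have h2 : (√(n : ℝ))⁻¹ * n = √(n : ℝ) := by
        rw [inv_mul_eq_div, Real.div_sqrt]
      rw [h1, h2]
  · have hGt : HasGaussianLaw (fun ω => ∑ k : Fin N, t k * increment U p₀ ω k) Q := by
      have := hG.map_fun (∑ k : Fin N, t k • ContinuousLinearMap.proj (R := ℝ)
        (φ := fun _ : Fin N => ℝ) k)
      simpa using this
    refine ⟨hGt.aemeasurable, ?_⟩
    rw [hGt.map_eq_gaussianReal]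
    congr 2
    · rw [integral_finsetSum _ fun (k : Fin N) _ =>
        ((hU.memLp_increment hpmf k).integrable one_le_two).const_mul (t k)]
      exact Finset.sum_eq_zero fun k _ => by
        rw [integral_const_mul, hU.integral_increment hpmf, mul_zero]
    · rw [variance_sum_mul (V := fun (k : Fin N) ω => increment U p₀ ω k)
          (fun k => hU.memLp_increment hpmf k) t,
        variance_sum_mul (V := fun (k : Fin N) ω => if X 0 ω = (k : ℕ) then (1 : ℝ) else 0)
          (fun k => memLp_ite_eq (hX 0) k) t]
      simp only [covariance_ite_eq hX hlaw, hU.covariance_increment hpmf]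

/-! ### The left-localized projection as a continuous map -/

/-- Projection of a vector of `ℝ^{s+1}` onto the left cone; the criterion takes its data from a
sequence, so the vector is continued by zero. -/
def leftProj (p : ℕ → ℝ) (S s : ℕ) (y : Fin (s + 1) → ℝ) : Fin (s + 1) → ℝ :=
  minimizer (finCriterion fun k => if h : k < s + 1 then y ⟨k, h⟩ else 0) (leftCone p S s)

lemma continuous_leftProj (p : ℕ → ℝ) (S s : ℕ) : Continuous (leftProj p S s) := by
  refine (isClosedConvexCone_leftCone p S s).continuous_minimizer.comp
    (continuous_pi fun k => ?_)
  by_cases h : k < s + 1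
  · simpa only [h, dite_true] using continuous_apply _
  · simpa only [h, dite_false] using continuous_const

lemma leftProj_restrict (p : ℕ → ℝ) (S s : ℕ) (w : ℕ → ℝ) :
    leftProj p S s (fun k => w k) = minimizer (finCriterion w) (leftCone p S s) := by
  rw [leftProj, finCriterion_congr fun k : Fin (s + 1) => ?_]
  rw [dif_pos k.2]

section Main

variable {Ω Ω' : Type*} [MeasurableSpace Ω] [MeasurableSpace Ω']
  {P : Measure Ω} [IsProbabilityMeasure P] {Q : Measure Ω'} [IsProbabilityMeasure Q]
  {p₀ : ℕ → ℝ} {S s : ℕ} {X : ℕ → Ω → ℕ} {U : ℝ → Ω' → ℝ}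

/-- Dividing by `n^{-1/2}` is multiplying by `√n`, for `n = 0` too since both sides vanish. -/
lemma div_rpow_neg_half (x : ℝ) (n : ℕ) : x / (n : ℝ) ^ (-(1 / 2) : ℝ) = √(n : ℝ) * x := by
  rw [Real.rpow_neg (Nat.cast_nonneg n), ← Real.sqrt_eq_rpow, div_inv_eq_mul, mul_comm]

lemma sum_mul_sub_eq (c : ℝ) (p p₀ : ℕ → ℝ) (s : ℕ) :
    ∑ k : Fin (s + 1), c * (p k - p₀ k) = c * (distFun p s - distFun p₀ s) := by
  rw [Fin.sum_univ_eq_sum_range (fun k => c * (p k - p₀ k)), ← Finset.mul_sum,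
    Finset.sum_sub_distrib, distFun, distFun]

/-- If the localized limit holds, then the estimated and the empirical distribution function at
`s`, centered and rescaled, have the same limit law, that of `U(F(s))`; since the former
dominates the latter, they differ by a negligible amount. -/
lemma isLittleOInProb_of_tendstoInDistribution (hpmf : IsPMF p₀) (hconv : IsConvexSeq p₀)
    (hS : ∀ k, S + 1 ≤ k → p₀ k = 0) (hX : ∀ i, Measurable (X i)) (hindep : iIndepFun X P)
    (hlaw : ∀ i k, P.real {ω | X i ω = k} = p₀ k) (hU : IsBrownianBridge U Q)
    (hs : s ∈ interiorKnots p₀ S)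
    (h : TendstoInDistribution
      (fun (n : ℕ) ω (k : Fin (s + 1)) => √(n : ℝ) * (lse X n ω k - p₀ k))
      atTop (leftMinimizer U p₀ S s) (fun _ => P) Q) :
    IsLittleOInProb P (fun n ω => distFun (lse X n ω) s - distFun (empiricalPMF X n ω) s)
      (fun n => (n : ℝ) ^ (-(1 / 2) : ℝ)) := by
  have hsum : Continuous fun v : Fin (s + 1) → ℝ => ∑ k, v k := by fun_prop
  have hA := h.continuous_comp hsum
  have hB := (tendstoInDistribution_empiricalPMF hpmf hX hindep hlaw hU (s + 1)).continuous_comp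
    hsum
  have hlim : (fun v : Fin (s + 1) → ℝ => ∑ k, v k) ∘ leftMinimizer U p₀ S s
      = (fun v : Fin (s + 1) → ℝ => ∑ k, v k) ∘ fun ω k => increment U p₀ ω k := by
    funext ω
    simp only [Function.comp_apply]
    rw [sum_leftMinimizer U p₀ S s (hU.zero ω), Fin.sum_univ_eq_sum_range (increment U p₀ ω),
      sum_increment U p₀ (hU.zero ω)]
  rw [hlim] at hA
  have hmeas := tendstoInMeasure_sub_of_le hA hB ?_
  · refine hmeas.congr_left fun n => ae_of_all _ fun ω => ?_
    simp only [Function.comp_apply]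
    rw [div_rpow_neg_half, sum_mul_sub_eq, sum_mul_sub_eq]
    ring
  · filter_upwards [ae_eventually_laplacian_lse_pos hX hindep hlaw hconv hS] with ω hω
    filter_upwards [hω] with n hn
    simp only [Function.comp_apply]
    rw [sum_mul_sub_eq, sum_mul_sub_eq]
    have := sum_le_sum_of_kink (memℓp_empiricalPMF X n ω) (lse_isMinimizer X n ω) (hn s hs)
    gcongr

/-- Almost surely, for all large `n`, the rescaled error of the estimator is the projection of the
rescaled empirical error, shifted at `s` by the rescaled excess mass. If the latter is
negligible, the continuous mapping theorem gives the localized limit. -/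
lemma tendstoInDistribution_of_isLittleOInProb (hpmf : IsPMF p₀) (hconv : IsConvexSeq p₀)
    (hS : ∀ k, S + 1 ≤ k → p₀ k = 0) (hX : ∀ i, Measurable (X i)) (hindep : iIndepFun X P)
    (hlaw : ∀ i k, P.real {ω | X i ω = k} = p₀ k) (hU : IsBrownianBridge U Q)
    (hs : s ∈ interiorKnots p₀ S)
    (h : IsLittleOInProb P (fun n ω => distFun (lse X n ω) s - distFun (empiricalPMF X n ω) s)
      (fun n => (n : ℝ) ^ (-(1 / 2) : ℝ))) :
    TendstoInDistribution
      (fun (n : ℕ) ω (k : Fin (s + 1)) => √(n : ℝ) * (lse X n ω k - p₀ k))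
      atTop (leftMinimizer U p₀ S s) (fun _ => P) Q := by
  simp only [IsLittleOInProb, div_rpow_neg_half] at h
  let y' : ℕ → Ω → Fin (s + 1) → ℝ := fun n ω k => √(n : ℝ) * (empiricalPMF X n ω k - p₀ k)
    + if (k : ℕ) = s then √(n : ℝ) * (distFun (lse X n ω) s - distFun (empiricalPMF X n ω) s)
      else 0
  have hz : ∀ n : ℕ, AEMeasurable
      (fun ω (k : Fin (s + 1)) => √(n : ℝ) * (lse X n ω k - p₀ k)) P := fun n =>
    (measurable_comp_empiricalPMF hX (fun q (k : Fin (s + 1)) =>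
      √(n : ℝ) * (minimizer (lsCriterion q) convexClass k - p₀ k)) n).aemeasurable
  have hy'm : ∀ n, AEMeasurable (y' n) P := fun n =>
    (measurable_comp_empiricalPMF hX (fun q (k : Fin (s + 1)) => √(n : ℝ) * (q k - p₀ k)
      + if (k : ℕ) = s then √(n : ℝ) * (distFun (minimizer (lsCriterion q) convexClass) s
        - distFun q s) else 0) n).aemeasurable
  have hy := tendstoInDistribution_empiricalPMF hpmf hX hindep hlaw hU (s + 1)
  have hy' : TendstoInDistribution y' atTop (fun ω k => increment U p₀ ω k) (fun _ => P) Q := by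
    refine tendstoInDistribution_of_tendstoInMeasure_sub y' _ hy ?_ hy'm
    rw [tendstoInMeasure_iff_norm] at h ⊢
    intro ε hε
    refine tendsto_of_tendsto_of_tendsto_of_le_of_le tendsto_const_nhds (h ε hε)
      (fun _ => zero_le) fun n => measure_mono fun ω hω => ?_
    simp only [Set.mem_ofPred_eq] at hω ⊢
    refine hω.trans ((pi_norm_le_iff_of_nonneg (norm_nonneg _)).2 fun k => ?_)
    simp only [y', Pi.sub_apply, Pi.zero_apply, sub_zero, add_sub_cancel_left]
    split_ifs
    · exact le_rfl
    · rw [norm_zero]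
      exact norm_nonneg _
  have hproj := hy'.continuous_comp (continuous_leftProj p₀ S s)
  have hlim : leftProj p₀ S s ∘ (fun ω k => increment U p₀ ω k) = leftMinimizer U p₀ S s :=
    funext fun ω => leftProj_restrict p₀ S s (increment U p₀ ω)
  rw [hlim] at hproj
  refine tendstoInDistribution_of_tendstoInMeasure_sub _ _ hproj ?_ hz
  refine tendstoInMeasure_of_tendsto_ae
    (fun n => ((hz n).sub (hproj.forall_aemeasurable n)).aestronglyMeasurable) ?_
  filter_upwards [ae_eventually_laplacian_lse_pos hX hindep hlaw hconv hS] with ω hω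
  refine tendsto_const_nhds.congr' ?_
  filter_upwards [hω] with n hn
  have hmin := isMinimizer_rescaled (memℓp_empiricalPMF X n ω) (lse_isMinimizer X n ω) hconv hs
    (fun k hk _ => hn k hk) (Real.sqrt_nonneg n)
  have heq := minimizer_eq ((isClosedConvexCone_leftCone p₀ S s).existsUnique _) hmin
  rw [← leftProj_restrict] at heq
  simp only [Pi.sub_apply, Function.comp_apply, Pi.zero_apply]
  rw [← heq, sub_self]

end Main

end ConvexLSE

end

theorem theorem5 {Ω Ω' : Type*} [MeasurableSpace Ω] [MeasurableSpace Ω']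
    (P : Measure Ω) [IsProbabilityMeasure P] (Q : Measure Ω') [IsProbabilityMeasure Q]
    (p₀ : ℕ → ℝ) (hpmf : IsPMF p₀) (hconv : IsConvexSeq p₀)
    (S : ℕ) (hS : Function.support p₀ = Set.Iic S)
    (X : ℕ → Ω → ℕ) (hX : ∀ i, Measurable (X i)) (hindep : iIndepFun X P)
    (hlaw : ∀ i k, P.real {ω | X i ω = k} = p₀ k)
    (U : ℝ → Ω' → ℝ) (hU : IsBrownianBridge U Q)
    (s : ℕ) (hs : s ∈ interiorKnots p₀ S) :
    (∀ ω, ∃! g, IsMinimizer (leftCriterion U p₀ s ω) (leftCone p₀ S s) g) ∧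
    (∀ ω, leftMinimizer U p₀ S s ω
          = (fun k : Fin (s + 1) => gHat U p₀ S ω (Fin.castLE (Nat.succ_le_succ hs.2.1.le) k)) ↔
        GHat U p₀ S ω s = U (distFun p₀ s) ω) ∧
    (TendstoInDistribution
        (fun (n : ℕ) ω (k : Fin (s + 1)) => √(n : ℝ) * (lse X n ω k - p₀ k))
        atTop (leftMinimizer U p₀ S s) (fun _ => P) Q ↔
      IsLittleOInProb P (fun n ω => distFun (lse X n ω) s - distFun (empiricalPMF X n ω) s)
        (fun n => (n : ℝ) ^ (-(1 / 2) : ℝ))) := by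
  have hS' : ∀ k, S + 1 ≤ k → p₀ k = 0 := fun k hk => by
    by_contra hne
    have hmem : k ∈ Function.support p₀ := hne
    rw [hS] at hmem
    exact absurd (Set.mem_Iic.1 hmem) (by omega)
  exact ⟨fun ω => (isClosedConvexCone_leftCone p₀ S s).existsUnique _,
    fun ω => leftMinimizer_eq_restrict_iff U p₀ hs (hU.zero ω),
    isLittleOInProb_of_tendstoInDistribution hpmf hconv hS' hX hindep hlaw hU hs,
    tendstoInDistribution_of_isLittleOInProb hpmf hconv hS' hX hindep hlaw hU hs⟩
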